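/- **Theorem.** For $n\ge 3$ let $X=(X_{i,j})_{1\le i<j\le n}$ be a random vector in $[0,\infty)^{\binom n2}$ with a density $f$ that is log-concave and down-monotone ($f(x)\ge f(y)$ whenever $x\le y$ coordinatewise). For $p>0$ let $G_{X,p}$ be the random graph on $\{1,\dots,n\}$ in which $\{i,j\}$, $i<j$, is an edge if and only if $X_{i,j}\le p$. Let $\sigma_{\min}\ge 0$ and $M\ge 0$ be given by $$\sigma_{\min}^2=\min_{i<j}\mathbb E X_{i,j}^2,\qquad M^2=\max_{T}\ \sup_{y}\ \max_{(i,j)\notin T}\ \mathbb E\big(X_{i,j}^2\,\big|\,X_T=y\big),$$ where $T$ ranges over the nonempty sets of index pairs, $X_T=(X_e)_{e\in T}$, $y$ ranges over the points of $[0,\infty)^{T}$ at which the marginal density of $X_T$ is positive, and the conditional expectation is taken with respect to the conditional density obtained from $f$. There are absolute constants $c_1,c_2>0$ such that, for all such $n$ and $X$ with $M<\infty$, all $\beta>1$ and all $p>0$: (i) If $p<\dfrac{c_1\sigma_{\min}}{n}$, then $$\Pr\big(G_{X,p}\text{ has a component of order}\ge\beta\log n\big)<\frac{12}{n^{\beta-1}}.$$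 (ii) If $p>\dfrac{c_2M\log(eM/\sigma_{\min})}{n}$, then $$\Pr\big(G_{X,p}\text{ has a component of order in }[\beta\log n,n/2]\big)<\frac1{n^{\beta-1}}$$ and $$\Pr\big(G_{X,p}\text{ has a unique giant component of order}>n/2\big)>1-\frac{5\beta}{\log n}-\frac1{n^{\beta-1}}.$$ -/

import Mathlib

open MeasureTheory
open scoped ENNReal

/-- The index set `{(i, j) : 1 ≤ i < j ≤ n}` of the coordinates (vertices are numbered from `0`). -/
abbrev EdgeIdx (n : ℕ) : Type := {e : Fin n × Fin n // e.1 < e.2}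

/-- `f` vanishes outside `[0,∞)^ι`, is nonnegative, and on `[0,∞)^ι` it is log-concave
(`log f` is concave with the convention `log 0 = -∞`) and down-monotone
(`f x ≥ f y` whenever `x ≤ y` coordinatewise). -/
structure IsLogConcaveDownMonotone {ι : Type*} (f : (ι → ℝ) → ℝ) : Prop where
  nonneg : ∀ x, 0 ≤ f x
  support : ∀ x, ¬ 0 ≤ x → f x = 0
  logConcave : ∀ x y : ι → ℝ, 0 ≤ x → 0 ≤ y → ∀ s t : ℝ, 0 < s → 0 < t → s + t = 1 →
    f x ^ s * f y ^ t ≤ f (s • x + t • y)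
  downMonotone : ∀ x y : ι → ℝ, 0 ≤ x → x ≤ y → f y ≤ f x

/-- The graph `G_{x,p}` on `n` vertices: for `i < j`, `{i, j}` is an edge iff `x_{ij} ≤ p`. -/
def thresholdGraph {n : ℕ} (x : EdgeIdx n → ℝ) (p : ℝ) : SimpleGraph (Fin n) where
  Adj i j := (∃ h : i < j, x ⟨(i, j), h⟩ ≤ p) ∨ (∃ h : j < i, x ⟨(j, i), h⟩ ≤ p)
  symm := ⟨fun _ _ h => h.symm⟩
  loopless := ⟨fun i h => by
    rcases h with ⟨h, _⟩ | ⟨h, _⟩ <;> exact lt_irrefl i h⟩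

/-- The order (number of vertices) of a connected component. -/
noncomputable def componentOrder {V : Type*} {G : SimpleGraph V} (C : G.ConnectedComponent) : ℕ :=
  C.supp.ncard

/-- `σ_min`, where `σ_min ^ 2 = min_{i < j} 𝔼 X_{ij} ^ 2`. -/
noncomputable def sigmaMin {Ω : Type*} [MeasurableSpace Ω] (P : Measure Ω) {n : ℕ}
    (X : Ω → EdgeIdx n → ℝ) : ℝ :=
  √(⨅ e : EdgeIdx n, ∫ ω, X ω e ^ 2 ∂P)

/-- The vector with coordinates `y` on `T` and `z` off `T`. -/
def glue {ι : Type*} [DecidableEq ι] (T : Finset ι) (y : {i // i ∈ T} → ℝ)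
    (z : {i // i ∉ T} → ℝ) : ι → ℝ :=
  fun i => if h : i ∈ T then y ⟨i, h⟩ else z ⟨i, h⟩

/-- The marginal density `f_T(y)` of `X_T`, for `X` with density `f`. -/
noncomputable def marginalDensity {ι : Type*} [Fintype ι] [DecidableEq ι]
    (f : (ι → ℝ) → ℝ) (T : Finset ι) (y : {i // i ∈ T} → ℝ) : ℝ≥0∞ :=
  ∫⁻ z : {i // i ∉ T} → ℝ, ENNReal.ofReal (f (glue T y z))

/-- `𝔼 (X_e ^ 2 | X_T = y)` for `e ∉ T`, computed from the conditional density
`z ↦ f (y, z) / f_T(y)`; meaningful where `f_T(y) ≠ 0`. -/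
noncomputable def condSecondMoment {ι : Type*} [Fintype ι] [DecidableEq ι]
    (f : (ι → ℝ) → ℝ) (T : Finset ι) (y : {i // i ∈ T} → ℝ) (e : {i // i ∉ T}) : ℝ≥0∞ :=
  (∫⁻ z : {i // i ∉ T} → ℝ, ENNReal.ofReal (z e ^ 2 * f (glue T y z))) / marginalDensity f T y

/-- `max_T sup_y max_{e ∉ T} 𝔼 (X_e ^ 2 | X_T = y)`, over nonempty `T` and over those
`y ∈ [0,∞)^T` at which the conditional distribution exists. -/
noncomputable def maxCondSecondMoment {ι : Type*} [Fintype ι] [DecidableEq ι]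
    (f : (ι → ℝ) → ℝ) : ℝ≥0∞ :=
  ⨆ (T : Finset ι) (_ : T.Nonempty) (y : {i // i ∈ T} → ℝ) (_ : 0 ≤ y)
    (_ : marginalDensity f T y ≠ 0) (e : {i // i ∉ T}), condSecondMoment f T y e

/-- `M`, on the scale of the coordinates: the square root of the largest conditional
second moment (to be used when that moment is finite). -/
noncomputable def maxCondRMS {ι : Type*} [Fintype ι] [DecidableEq ι]
    (f : (ι → ℝ) → ℝ) : ℝ :=
  √(maxCondSecondMoment f).toReal

/-!
Marginals of a log-concave density are log-concave (Prékopa–Leindler), hence so are all conditional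
densities, and a one-dimensional decreasing log-concave density is controlled by its second moment:
it is at most a constant over `σ` at the origin, and its tail decays exponentially at scale `M`. A
Loomis–Whitney inequality for log-concave functions reduces the joint density of several
coordinates at the origin to their one-dimensional marginals. So the event that all coordinates in
`S` are at most `p` and all those in a disjoint set `T` exceed `p` has probability at most
`(C p / σ) ^ |S| * exp (- c p / M) ^ |T|`, although the coordinates are dependent.

A component of order `k` contains a tree on `k` vertices, given by one of at most `(e n) ^ k` parent
maps, and has `k (n - k)` absent edges in its boundary; the union bound over parent maps rules out
large components for small `p` and medium components for large `p`. If no component has more than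
half of the vertices, some union of components has between `n / 3` and `2 n / 3` of them, and
its boundary is too large to be entirely absent.
-/

section PrekopaLeindler

/-- Lebesgue measure on `[0,∞)`. -/
noncomputable def halfLine : Measure ℝ := volume.restrict (Set.Ici 0)

instance : SigmaFinite halfLine := by unfold halfLine; infer_instance

theorem ae_halfLine_nonneg : ∀ᵐ r ∂halfLine, (0 : ℝ) ≤ r :=
  ae_restrict_mem measurableSet_Ici

theorem halfLine_eq_iSup_of_isLowerSet {U : Set ℝ} (hU : IsLowerSet U) :
    halfLine U = ⨆ r ∈ U, ENNReal.ofReal r := by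
  rw [halfLine, Measure.restrict_apply' measurableSet_Ici]
  apply le_antisymm
  · rcases eq_or_ne (⨆ r ∈ U, ENNReal.ofReal r) ∞ with h | h
    · exact h ▸ le_top
    · have hsub : U ∩ Set.Ici 0 ⊆ Set.Icc 0 (⨆ r ∈ U, ENNReal.ofReal r).toReal :=
        fun x ⟨hx, hx0⟩ => ⟨hx0, (ENNReal.ofReal_le_iff_le_toReal h).1
          (le_iSup₂ (f := fun r (_ : r ∈ U) => ENNReal.ofReal r) x hx)⟩
      refine (measure_mono hsub).trans ?_
      rw [Real.volume_Icc, sub_zero, ENNReal.ofReal_toReal h]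
  · refine iSup₂_le fun r hr => ?_
    calc ENNReal.ofReal r = volume (Set.Icc 0 r) := by rw [Real.volume_Icc, sub_zero]
      _ ≤ volume (U ∩ Set.Ici 0) := measure_mono fun x hx => ⟨hU hx.2 hr, hx.1⟩

theorem brunn_minkowski_halfLine {U V W : Set ℝ} (hU : IsLowerSet U) (hV : IsLowerSet V)
    (hW : IsLowerSet W) (hU0 : 0 ∈ U) (hV0 : 0 ∈ V) {s t : ℝ} (hs : 0 ≤ s) (ht : 0 ≤ t)
    (hUVW : ∀ a ∈ U, ∀ b ∈ V, s * a + t * b ∈ W) :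
    ENNReal.ofReal s * halfLine U + ENNReal.ofReal t * halfLine V ≤ halfLine W := by
  have max_mem : ∀ {S : Set ℝ}, 0 ∈ S → ∀ a ∈ S, max a 0 ∈ S := fun h0 a ha => by
    rcases max_choice a 0 with h | h <;> rwa [h]
  rw [halfLine_eq_iSup_of_isLowerSet hU, halfLine_eq_iSup_of_isLowerSet hV,
    halfLine_eq_iSup_of_isLowerSet hW]
  simp_rw [ENNReal.mul_iSup]
  refine ENNReal.biSup_add_biSup_le' ⟨0, hU0⟩ ⟨0, hV0⟩ fun a ha b hb => ?_
  calc ENNReal.ofReal s * ENNReal.ofReal a + ENNReal.ofReal t * ENNReal.ofReal b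
      ≤ ENNReal.ofReal s * ENNReal.ofReal (max a 0)
        + ENNReal.ofReal t * ENNReal.ofReal (max b 0) := by
        gcongr <;> exact le_max_left _ _
    _ = ENNReal.ofReal (s * max a 0 + t * max b 0) := by
        rw [← ENNReal.ofReal_mul hs, ← ENNReal.ofReal_mul ht,
          ENNReal.ofReal_add (by positivity) (by positivity)]
    _ ≤ ⨆ r ∈ W, ENNReal.ofReal r :=
        le_iSup₂ (f := fun r (_ : r ∈ W) => ENNReal.ofReal r) _
          (hUVW _ (max_mem hU0 a ha) _ (max_mem hV0 b hb))

theorem lintegral_eq_lintegral_measure_ofReal_lt {α : Type*} [MeasurableSpace α] {μ : Measure α}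
    {f : α → ℝ≥0∞} (hf : Measurable f) (hfin : ∀ x, f x ≠ ∞) :
    ∫⁻ x, f x ∂μ = ∫⁻ t in Set.Ioi (0 : ℝ), μ {x | ENNReal.ofReal t < f x} := by
  calc ∫⁻ x, f x ∂μ = ∫⁻ x, ENNReal.ofReal (f x).toReal ∂μ := by
        simp_rw [ENNReal.ofReal_toReal (hfin _)]
    _ = ∫⁻ t in Set.Ioi (0 : ℝ), μ {x | t < (f x).toReal} :=
        lintegral_eq_lintegral_meas_lt μ (.of_forall fun _ => ENNReal.toReal_nonneg)
          hf.ennreal_toReal.aemeasurable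
    _ = _ := by
        refine setLIntegral_congr_fun measurableSet_Ioi fun t (ht : 0 < t) => ?_
        simp_rw [ENNReal.ofReal_lt_iff_lt_toReal ht.le (hfin _)]

theorem ennreal_geom_mean_le_arith_mean2_weighted (a b : ℝ≥0∞) {s t : ℝ} (hs : 0 < s)
    (ht : 0 < t) (hst : s + t = 1) :
    a ^ s * b ^ t ≤ ENNReal.ofReal s * a + ENNReal.ofReal t * b := by
  have hconj : s⁻¹.HolderConjugate t⁻¹ :=
    Real.holderConjugate_iff.2 ⟨(one_lt_inv₀ hs).2 (by linarith), by simpa using hst⟩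
  simpa only [ENNReal.rpow_rpow_inv hs.ne', ENNReal.rpow_rpow_inv ht.ne',
    ENNReal.ofReal_inv_of_pos hs, ENNReal.ofReal_inv_of_pos ht, div_eq_mul_inv, inv_inv,
    mul_comm] using ENNReal.young_inequality (a ^ s) (b ^ t) hconj

theorem lintegral_halfLine_min_of_antitone {f : ℝ → ℝ≥0∞} (hf : Antitone f) {c : ℝ≥0∞}
    (h : f 0 ≤ c) : ∫⁻ x, min (f x) c ∂halfLine = ∫⁻ x, f x ∂halfLine := by
  refine lintegral_congr_ae ?_
  filter_upwards [ae_halfLine_nonneg] with x hx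
  exact min_eq_left ((hf hx).trans h)

variable {f g h : ℝ → ℝ≥0∞} {s t : ℝ}

theorem prekopa_leindler_of_zero_eq_one (hf : Antitone f) (hg : Antitone g) (hh : Antitone h)
    (hs : 0 < s) (ht : 0 < t) (hst : s + t = 1)
    (H : ∀ a b, f a ^ s * g b ^ t ≤ h (s * a + t * b)) (hf0 : f 0 = 1) (hg0 : g 0 = 1) :
    ENNReal.ofReal s * ∫⁻ x, f x ∂halfLine + ENNReal.ofReal t * ∫⁻ x, g x ∂halfLine
      ≤ ∫⁻ x, h x ∂halfLine := by
  have layers {k : ℝ → ℝ≥0∞} (hk : Antitone k) : ∫⁻ x, min (k x) 1 ∂halfLine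
      = ∫⁻ u in Set.Ioi (0 : ℝ), halfLine {x | ENNReal.ofReal u < min (k x) 1} :=
    lintegral_eq_lintegral_measure_ofReal_lt (hk.measurable.min measurable_const)
      fun x => ne_top_of_le_ne_top ENNReal.one_ne_top (min_le_right _ _)
  have lower {k : ℝ → ℝ≥0∞} (hk : Antitone k) (u : ℝ) :
      IsLowerSet {x | ENNReal.ofReal u < min (k x) 1} := fun a b hba ha =>
    (show ENNReal.ofReal u < min (k a) 1 from ha).trans_le (min_le_min_right 1 (hk hba))
  have level (u : ℝ) : ENNReal.ofReal s * halfLine {x | ENNReal.ofReal u < min (f x) 1}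
      + ENNReal.ofReal t * halfLine {x | ENNReal.ofReal u < min (g x) 1}
      ≤ halfLine {x | ENNReal.ofReal u < min (h x) 1} := by
    rcases le_or_gt 1 u with hu | hu
    · simp [ENNReal.one_le_ofReal.2 hu |>.not_gt]
    refine brunn_minkowski_halfLine (lower hf u) (lower hg u) (lower hh u) (by simp [hf0, hu])
      (by simp [hg0, hu]) hs.le ht.le fun a ha b hb => lt_min ?_ (ENNReal.ofReal_lt_one.2 hu)
    calc ENNReal.ofReal u = ENNReal.ofReal u ^ s * ENNReal.ofReal u ^ t := by
          rw [← ENNReal.rpow_add_of_nonneg _ _ hs.le ht.le, hst, ENNReal.rpow_one]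
      _ < f a ^ s * g b ^ t :=
          ENNReal.mul_lt_mul (ENNReal.rpow_lt_rpow (lt_min_iff.1 ha).1 hs)
            (ENNReal.rpow_lt_rpow (lt_min_iff.1 hb).1 ht)
      _ ≤ h (s * a + t * b) := H a b
  rw [← lintegral_halfLine_min_of_antitone hf hf0.le,
    ← lintegral_halfLine_min_of_antitone hg hg0.le, layers hf, layers hg,
    ← lintegral_const_mul' _ _ ENNReal.ofReal_ne_top,
    ← lintegral_const_mul' _ _ ENNReal.ofReal_ne_top]
  calc _ ≤ ∫⁻ u in Set.Ioi (0 : ℝ),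
          (ENNReal.ofReal s * halfLine {x | ENNReal.ofReal u < min (f x) 1}
            + ENNReal.ofReal t * halfLine {x | ENNReal.ofReal u < min (g x) 1}) :=
        le_lintegral_add _ _
    _ ≤ ∫⁻ u in Set.Ioi (0 : ℝ), halfLine {x | ENNReal.ofReal u < min (h x) 1} :=
        lintegral_mono level
    _ = ∫⁻ x, min (h x) 1 ∂halfLine := (layers hh).symm
    _ ≤ ∫⁻ x, h x ∂halfLine := lintegral_mono fun x => min_le_left _ _

theorem prekopa_leindler_of_zero_ne_top (hf : Antitone f) (hg : Antitone g) (hh : Antitone h)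
    (hs : 0 < s) (ht : 0 < t) (hst : s + t = 1)
    (H : ∀ a b, f a ^ s * g b ^ t ≤ h (s * a + t * b))
    (hf0 : f 0 ≠ 0) (hf1 : f 0 ≠ ∞) (hg0 : g 0 ≠ 0) (hg1 : g 0 ≠ ∞) :
    (∫⁻ x, f x ∂halfLine) ^ s * (∫⁻ x, g x ∂halfLine) ^ t ≤ ∫⁻ x, h x ∂halfLine := by
  set C := f 0 ^ s * g 0 ^ t with hC
  have hC0 : C ≠ 0 := mul_ne_zero (by simp [hf0, hf1]) (by simp [hg0, hg1])
  have hC1 : C ≠ ∞ := ENNReal.mul_ne_top (ENNReal.rpow_ne_top_of_nonneg hs.le hf1)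
    (ENNReal.rpow_ne_top_of_nonneg ht.le hg1)
  have div_antitone (c : ℝ≥0∞) {k : ℝ → ℝ≥0∞} (hk : Antitone k) : Antitone fun x => k x / c :=
    fun x y hxy => ENNReal.div_le_div_right (hk hxy) c
  have div_rpow_mul (u v : ℝ≥0∞) : (u / f 0) ^ s * (v / g 0) ^ t = u ^ s * v ^ t / C := by
    rw [ENNReal.div_rpow_of_nonneg _ _ hs.le, ENNReal.div_rpow_of_nonneg _ _ ht.le, hC,
      ENNReal.mul_div_mul_comm (by simp [hf0, hf1]) (by simp [hg0, hg1])]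
  have lintegral_div (c : ℝ≥0∞) {k : ℝ → ℝ≥0∞} (hk : Antitone k) :
      ∫⁻ x, k x / c ∂halfLine = (∫⁻ x, k x ∂halfLine) / c := by
    simp_rw [div_eq_mul_inv]
    rw [lintegral_mul_const _ hk.measurable]
  rw [← ENNReal.mul_le_mul_iff_left (ENNReal.inv_ne_zero.2 hC1) (ENNReal.inv_ne_top.2 hC0),
    ← div_eq_mul_inv, ← div_eq_mul_inv]
  calc (∫⁻ x, f x ∂halfLine) ^ s * (∫⁻ x, g x ∂halfLine) ^ t / C
      = (∫⁻ x, f x / f 0 ∂halfLine) ^ s * (∫⁻ x, g x / g 0 ∂halfLine) ^ t := by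
        rw [lintegral_div _ hf, lintegral_div _ hg, div_rpow_mul]
    _ ≤ ENNReal.ofReal s * ∫⁻ x, f x / f 0 ∂halfLine
        + ENNReal.ofReal t * ∫⁻ x, g x / g 0 ∂halfLine :=
        ennreal_geom_mean_le_arith_mean2_weighted _ _ hs ht hst
    _ ≤ ∫⁻ x, h x / C ∂halfLine :=
        prekopa_leindler_of_zero_eq_one (div_antitone _ hf) (div_antitone _ hg)
          (div_antitone _ hh) hs ht hst
          (fun a b => (div_rpow_mul _ _).trans_le (ENNReal.div_le_div_right (H a b) C))
          (ENNReal.div_self hf0 hf1) (ENNReal.div_self hg0 hg1)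
    _ = (∫⁻ x, h x ∂halfLine) / C := lintegral_div C hh

theorem tendsto_lintegral_min_natCast {α : Type*} [MeasurableSpace α] {μ : Measure α}
    {f : α → ℝ≥0∞} (hf : Measurable f) :
    Filter.Tendsto (fun N : ℕ => ∫⁻ x, min (f x) N ∂μ) Filter.atTop (nhds (∫⁻ x, f x ∂μ)) := by
  refine lintegral_tendsto_of_tendsto_of_monotone
    (fun N => (hf.min measurable_const).aemeasurable) ?_ ?_
  · exact .of_forall fun x a b hab => min_le_min le_rfl (Nat.cast_le.2 hab)
  · refine .of_forall fun x => ?_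
    simpa using (tendsto_const_nhds (x := f x)).min ENNReal.tendsto_nat_nhds_top

theorem prekopa_leindler_antitone (hf : Antitone f) (hg : Antitone g) (hh : Antitone h)
    (hs : 0 < s) (ht : 0 < t) (hst : s + t = 1)
    (H : ∀ a b, f a ^ s * g b ^ t ≤ h (s * a + t * b)) :
    (∫⁻ x, f x ∂halfLine) ^ s * (∫⁻ x, g x ∂halfLine) ^ t ≤ ∫⁻ x, h x ∂halfLine := by
  have lintegral_eq_zero {k : ℝ → ℝ≥0∞} (hk : Antitone k) (h0 : k 0 = 0) :
      ∫⁻ x, k x ∂halfLine = 0 := by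
    rw [← lintegral_halfLine_min_of_antitone hk h0.le]; simp
  rcases eq_or_ne (f 0) 0 with hf0 | hf0
  · simp [lintegral_eq_zero hf hf0, hs]
  rcases eq_or_ne (g 0) 0 with hg0 | hg0
  · simp [lintegral_eq_zero hg hg0, ht]
  rcases eq_or_ne (∫⁻ x, f x ∂halfLine) 0 with hf1 | hf1
  · simp [hf1, hs]
  rcases eq_or_ne (∫⁻ x, g x ∂halfLine) 0 with hg1 | hg1
  · simp [hg1, ht]
  have htendsto := ENNReal.Tendsto.mul
    ((tendsto_lintegral_min_natCast (μ := halfLine) hf.measurable).ennrpow_const s)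
    (Or.inl (by simp [hf1, hs.not_gt]))
    ((tendsto_lintegral_min_natCast (μ := halfLine) hg.measurable).ennrpow_const t)
    (Or.inl (by simp [hg1, ht.not_gt]))
  refine le_of_tendsto htendsto ?_
  filter_upwards [Filter.eventually_ge_atTop 1] with N hN
  have hN0 : (N : ℝ≥0∞) ≠ 0 := Nat.cast_ne_zero.2 (Nat.one_le_iff_ne_zero.1 hN)
  have min_ne_zero {c : ℝ≥0∞} (hc : c ≠ 0) : min c N ≠ 0 :=
    (lt_min (pos_iff_ne_zero.2 hc) (pos_iff_ne_zero.2 hN0)).ne'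
  have min_ne_top (c : ℝ≥0∞) : min c N ≠ ∞ :=
    ne_top_of_le_ne_top (ENNReal.natCast_ne_top N) (min_le_right _ _)
  refine prekopa_leindler_of_zero_ne_top (fun x y hxy => min_le_min (hf hxy) le_rfl)
    (fun x y hxy => min_le_min (hg hxy) le_rfl) hh hs ht hst (fun a b => le_trans ?_ (H a b))
    (min_ne_zero hf0) (min_ne_top _) (min_ne_zero hg0) (min_ne_top _)
  gcongr <;> exact min_le_left _ _

end PrekopaLeindler

section IntegrateOut

/-- Integration over the coordinates in `s`, each running through `[0,∞)`: this turns a density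
into a marginal density. The result is still a function of all coordinates, constant in those
in `s`. -/
noncomputable abbrev integrateOut {ι : Type*} [DecidableEq ι] (s : Finset ι)
    (F : (ι → ℝ) → ℝ≥0∞) : (ι → ℝ) → ℝ≥0∞ :=
  lmarginal (fun _ => halfLine) s F

variable {ι : Type*} [DecidableEq ι] {F : (ι → ℝ) → ℝ≥0∞}

theorem lmarginal_update_of_dependsOn {μ : ι → Measure ℝ} {s : Finset ι} {t : Set ι}
    (hF : DependsOn F t) {i : ι} (hi : i ∉ t) (x : ι → ℝ) (r : ℝ) :
    lmarginal μ s F (Function.update x i r) = lmarginal μ s F x := by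
  refine lintegral_congr fun y => hF fun j hj => ?_
  by_cases hjs : j ∈ s
  · simp [Function.updateFinset, hjs]
  · simp [Function.updateFinset, hjs, ne_of_mem_of_not_mem hj hi]

theorem integrateOut_insert {s : Finset ι} (hF : Measurable F) {i : ι} (hi : i ∉ s) (x : ι → ℝ) :
    integrateOut (insert i s) F x
      = ∫⁻ r, integrateOut s F (Function.update x i r) ∂halfLine :=
  lmarginal_insert F hF hi x

theorem integrateOut_union {s t : Finset ι} (hF : Measurable F) (hst : Disjoint s t) :
    integrateOut (s ∪ t) F = integrateOut s (integrateOut t F) :=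
  lmarginal_union _ F hF hst

theorem integrateOut_mul_of_dependsOn {s : Finset ι} (hF : Measurable F) {A : (ι → ℝ) → ℝ≥0∞}
    (hA : DependsOn A {i | i ∉ s}) (x : ι → ℝ) :
    integrateOut s (fun y => A y * F y) x = A x * integrateOut s F x := by
  rw [integrateOut, integrateOut, lmarginal, lmarginal,
    ← lintegral_const_mul (f := fun y => F (Function.updateFinset x s y)) _
      (hF.comp measurable_updateFinset)]
  refine lintegral_congr fun y => congrArg (· * _) (hA fun i hi => ?_)
  simp [Function.updateFinset, Set.mem_ofPred_eq ▸ hi]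

theorem lintegral_halfLine_comp_mul {h : ℝ → ℝ≥0∞} (hh : Measurable h) {θ : ℝ} (hθ : 0 < θ) :
    ∫⁻ r, h (θ * r) ∂halfLine = ENNReal.ofReal θ⁻¹ * ∫⁻ r, h r ∂halfLine := by
  have eq_indicator (k : ℝ → ℝ≥0∞) : ∫⁻ r, k r ∂halfLine = ∫⁻ r, (Set.Ici 0).indicator k r :=
    (lintegral_indicator measurableSet_Ici _).symm
  rw [eq_indicator, eq_indicator, ← abs_of_pos (inv_pos.2 hθ), ← smul_eq_mul,
    ← lintegral_smul_measure, ← Real.map_volume_mul_left hθ.ne',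
    lintegral_map (hh.indicator measurableSet_Ici) (measurable_const_mul θ)]
  refine lintegral_congr fun r => ?_
  simp [Set.indicator, mul_nonneg_iff_of_pos_left hθ]

theorem integrateOut_comp_smul (hF : Measurable F) {θ : ℝ} (hθ : 0 < θ) (s : Finset ι)
    (x : ι → ℝ) :
    integrateOut s (fun y => F (θ • y)) x
      = ENNReal.ofReal θ⁻¹ ^ s.card * integrateOut s F (θ • x) := by
  induction s using Finset.induction_on generalizing x with
  | empty => simp
  | insert i s hi ih =>
    have smul_update (r : ℝ) :
        θ • Function.update x i r = Function.update (θ • x) i (θ * r) := by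
      rw [← smul_eq_mul, Function.update_smul]
    have hm : Measurable fun r => integrateOut s F (Function.update (θ • x) i r) :=
      (hF.lmarginal _).comp (measurable_update _)
    rw [integrateOut_insert (F := fun y => F (θ • y)) (hF.comp (measurable_const_smul θ)) hi,
      integrateOut_insert hF hi]
    simp_rw [ih, smul_update]
    rw [lintegral_const_mul' _ _ (ENNReal.pow_ne_top ENNReal.ofReal_ne_top),
      lintegral_halfLine_comp_mul hm hθ, Finset.card_insert_of_notMem hi, pow_succ, mul_assoc]

end IntegrateOut

/-- An extended-valued log-concave decreasing function on an ordered real vector space; used on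
the line and for densities of several variables. -/
structure IsLogConcaveAntitone {E : Type*} [AddCommMonoid E] [Module ℝ E] [Preorder E]
    (F : E → ℝ≥0∞) : Prop where
  antitone : Antitone F
  logConcave : ∀ x y : E, ∀ s t : ℝ, 0 < s → 0 < t → s + t = 1 →
    F x ^ s * F y ^ t ≤ F (s • x + t • y)

/-- A measurable log-concave antitone function on `[0,∞)^ι`, extended to all of `ι → ℝ`
so as to depend on the positive parts of the coordinates only. -/
structure IsOrthantLogConcave {ι : Type*} (F : (ι → ℝ) → ℝ≥0∞) : Prop
    extends IsLogConcaveAntitone F where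
  measurable : Measurable F
  sup_zero : ∀ x, F (x ⊔ 0) = F x

namespace IsOrthantLogConcave

variable {ι : Type*} {F : (ι → ℝ) → ℝ≥0∞}

theorem le_zero (hF : IsOrthantLogConcave F) (x : ι → ℝ) : F x ≤ F 0 := by
  rw [← hF.sup_zero]
  exact hF.antitone le_sup_right

variable [DecidableEq ι]

theorem le_update_zero (hF : IsOrthantLogConcave F) (x : ι → ℝ) (i : ι) :
    F x ≤ F (Function.update x i 0) := by
  rw [← hF.sup_zero x, ← hF.sup_zero (Function.update x i 0)]
  refine hF.antitone fun j => ?_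
  rcases eq_or_ne j i with rfl | hj
  · simp
  · simp [hj]

theorem slice (hF : IsOrthantLogConcave F) (x : ι → ℝ) (i : ι) :
    IsLogConcaveAntitone fun r => F (Function.update x i r) where
  antitone _ _ h := hF.antitone (update_le_update_iff.2 ⟨h, fun _ _ => le_rfl⟩)
  logConcave a b s t hs ht hst := by
    refine (hF.logConcave _ _ s t hs ht hst).trans_eq (congrArg F ?_)
    ext j
    rcases eq_or_ne j i with rfl | hj
    · simp
    · simp [hj, ← add_mul, hst]

theorem integrateOut_singleton (hF : IsOrthantLogConcave F) (i : ι) :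
    IsOrthantLogConcave (integrateOut {i} F) where
  measurable := hF.measurable.lmarginal _
  antitone x y h := by
    simp only [lmarginal_singleton]
    exact lintegral_mono fun r => hF.antitone (update_le_update_iff.2 ⟨le_rfl, fun j _ => h j⟩)
  sup_zero x := by
    simp only [lmarginal_singleton]
    refine lintegral_congr fun r => ?_
    rw [← hF.sup_zero, ← hF.sup_zero (Function.update x i r)]
    congr 1
    ext j
    rcases eq_or_ne j i with rfl | hj
    · simp
    · simp [hj]
  logConcave x y s t hs ht hst := by
    simp only [lmarginal_singleton]
    refine prekopa_leindler_antitone (hF.slice x i).antitone (hF.slice y i).antitone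
      (hF.slice _ i).antitone hs ht hst fun a b => ?_
    refine (hF.logConcave _ _ s t hs ht hst).trans_eq (congrArg F ?_)
    ext j
    rcases eq_or_ne j i with rfl | hj
    · simp
    · simp [hj]

end IsOrthantLogConcave

theorem isOrthantLogConcave_integrateOut {ι : Type*} [DecidableEq ι] {F : (ι → ℝ) → ℝ≥0∞}
    (hF : IsOrthantLogConcave F) (s : Finset ι) : IsOrthantLogConcave (integrateOut s F) := by
  induction s using Finset.induction_on with
  | empty => simpa using hF
  | insert i s hi ih =>
    rw [Finset.insert_eq,
      integrateOut_union hF.measurable (Finset.disjoint_singleton_left.2 hi)]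
    exact ih.integrateOut_singleton i

section LoomisWhitney

variable {ι : Type*} [DecidableEq ι] {S : Finset ι}

-- One coordinate is integrated at a time: `G j` does not see the `j`-th coordinate, and Hölder's
-- inequality applies to the remaining `|S| - 1` factors.
theorem lintegral_prod_rpow_update_le (hS : 2 ≤ S.card) {j : ι} (hj : j ∈ S) {μ : Measure ℝ}
    {G : ι → (ι → ℝ) → ℝ≥0∞} (hG : ∀ i, Measurable (G i))
    {x : ι → ℝ} (hGj : ∀ r, G j (Function.update x j r) = G j x) :
    ∫⁻ r, ∏ i ∈ S, G i (Function.update x j r) ^ (1 / (S.card - 1 : ℝ)) ∂μ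
      ≤ G j x ^ (1 / (S.card - 1 : ℝ))
        * ∏ i ∈ S.erase j, (∫⁻ r, G i (Function.update x j r) ∂μ) ^ (1 / (S.card - 1 : ℝ)) := by
  have hS' : (2 : ℝ) ≤ S.card := mod_cast hS
  have hm (i : ι) : Measurable fun r => G i (Function.update x j r) :=
    (hG i).comp (measurable_update x)
  simp_rw [← Finset.mul_prod_erase S _ hj, hGj]
  rw [lintegral_const_mul _ (Finset.measurable_fun_prod _ fun i _ => (hm i).pow_const _)]
  gcongr
  refine ENNReal.lintegral_prod_norm_pow_le _ (fun i _ => (hm i).aemeasurable) ?_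
    fun _ _ => one_div_nonneg.2 (by linarith)
  rw [Finset.sum_const, Finset.card_erase_of_mem hj, nsmul_eq_mul, Nat.cast_sub (by omega),
    Nat.cast_one]
  exact mul_one_div_cancel (by linarith)

theorem lmarginal_prod_rpow_le (hS : 2 ≤ S.card) {μ : ι → Measure ℝ} [∀ i, SigmaFinite (μ i)]
    {g : ι → (ι → ℝ) → ℝ≥0∞} (hg : ∀ i, Measurable (g i)) (hgi : ∀ i, DependsOn (g i) {i}ᶜ)
    {s : Finset ι} (hs : s ⊆ S) (x : ι → ℝ) :
    lmarginal μ s (fun x => ∏ i ∈ S, g i x ^ (1 / (S.card - 1 : ℝ))) x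
      ≤ ∏ i ∈ S, lmarginal μ (s.erase i) (g i) x ^ (1 / (S.card - 1 : ℝ)) := by
  induction s using Finset.induction_on generalizing x with
  | empty => simp
  | insert j s hj ih =>
    have hjS : j ∈ S := hs (Finset.mem_insert_self _ _)
    rw [lmarginal_insert _ (Finset.measurable_fun_prod _ fun i _ => (hg i).pow_const _) hj]
    refine (lintegral_mono fun r => ih ((Finset.subset_insert _ _).trans hs) _).trans ?_
    refine (lintegral_prod_rpow_update_le hS hjS (fun i => (hg i).lmarginal μ) fun r =>
      lmarginal_update_of_dependsOn (hgi j) (by simp) x r).trans_eq ?_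
    rw [← Finset.mul_prod_erase S _ hjS, Finset.erase_insert hj, Finset.erase_eq_of_notMem hj]
    refine congrArg _ (Finset.prod_congr rfl fun i hi => ?_)
    rw [Finset.erase_insert_of_ne (Finset.ne_of_mem_erase hi).symm,
      lmarginal_insert _ (hg i) (fun h => hj (Finset.mem_of_mem_erase h))]

theorem inv_one_sub_inv_pow_le_exp {k : ℕ} (hk : 2 ≤ k) :
    ((((k : ℝ) - 1) / k)⁻¹) ^ (k - 1) ≤ Real.exp 1 := by
  have hk' : (0 : ℝ) < k - 1 := by
    have : (2 : ℝ) ≤ k := mod_cast hk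
    linarith
  calc ((((k : ℝ) - 1) / k)⁻¹) ^ (k - 1) = (1 / ((k : ℝ) - 1) + 1) ^ (k - 1) := by
        congr 1; field_simp; ring
    _ ≤ Real.exp (1 / (k - 1)) ^ (k - 1) :=
        pow_le_pow_left₀ (by positivity) (Real.add_one_le_exp _) _
    _ = Real.exp 1 := by
        rw [← Real.exp_nat_mul, Nat.cast_sub (by omega), Nat.cast_one,
          mul_one_div_cancel hk'.ne']

variable {F : (ι → ℝ) → ℝ≥0∞}

namespace IsOrthantLogConcave

-- Concavity of `log F` on the segment from the origin to `x` gives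
-- `F x ^ θ * F 0 ^ (1 - θ) ≤ F (θ • x)` with `θ = 1 - 1 / |S|`; then zero out one coordinate of
-- `θ • x` in each of `|S|` copies.
theorem mul_zero_rpow_le_prod (hF : IsOrthantLogConcave F) (hS : 2 ≤ S.card) (x : ι → ℝ) :
    F x * F 0 ^ (1 / (S.card - 1 : ℝ))
      ≤ ∏ i ∈ S, F (Function.update (((S.card - 1 : ℝ) / S.card) • x) i 0)
          ^ (1 / (S.card - 1 : ℝ)) := by
  set k : ℝ := (S.card : ℝ) with hk
  have hk2 : (2 : ℝ) ≤ k := hk ▸ mod_cast hS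
  have hk1 : k - 1 ≠ 0 := by linarith
  set θ : ℝ := (k - 1) / k with hθ
  have hθ0 : 0 < θ := div_pos (by linarith) (by linarith)
  have hθ1 : θ < 1 := (div_lt_one (by linarith)).2 (by linarith)
  have hq : 0 ≤ 1 / (k - 1) := one_div_nonneg.2 (by linarith)
  have hseg : F x ^ θ * F 0 ^ (1 - θ) ≤ F (θ • x) := by
    simpa using hF.logConcave x 0 θ (1 - θ) hθ0 (by linarith) (by ring)
  calc F x * F 0 ^ (1 / (k - 1)) = (F x ^ θ * F 0 ^ (1 - θ)) ^ (1 / (k - 1) * k) := by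
        rw [ENNReal.mul_rpow_of_nonneg _ _ (by positivity), ← ENNReal.rpow_mul,
          ← ENNReal.rpow_mul,
          show θ * (1 / (k - 1) * k) = 1 by rw [hθ]; field_simp,
          show (1 - θ) * (1 / (k - 1) * k) = 1 / (k - 1) by rw [hθ]; field_simp; ring,
          ENNReal.rpow_one]
    _ ≤ F (θ • x) ^ (1 / (k - 1) * k) := by gcongr
    _ = ∏ _i ∈ S, F (θ • x) ^ (1 / (k - 1)) := by
        rw [Finset.prod_const, ENNReal.rpow_mul, hk, ENNReal.rpow_natCast]
    _ ≤ _ := by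
        gcongr with i
        exact hF.le_update_zero _ i

theorem integrateOut_mul_zero_rpow_le (hF : IsOrthantLogConcave F) (hS : 2 ≤ S.card) :
    integrateOut S F 0 * F 0 ^ (1 / (S.card - 1 : ℝ))
      ≤ ENNReal.ofReal (((S.card - 1 : ℝ) / S.card)⁻¹) ^ S.card
        * ∏ i ∈ S, integrateOut (S.erase i) F 0 ^ (1 / (S.card - 1 : ℝ)) := by
  set q : ℝ := 1 / (S.card - 1 : ℝ)
  set θ : ℝ := (S.card - 1 : ℝ) / S.card
  have hθ : 0 < θ := by
    have : (2 : ℝ) ≤ S.card := mod_cast hS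
    exact div_pos (by linarith) (by linarith)
  have hm (i : ι) : Measurable fun x : ι → ℝ => F (Function.update x i 0) :=
    hF.measurable.comp measurable_update_left
  calc integrateOut S F 0 * F 0 ^ q = integrateOut S (fun y => F y * F 0 ^ q) 0 :=
        (lintegral_mul_const _ (hF.measurable.comp measurable_updateFinset)).symm
    _ ≤ integrateOut S (fun y => ∏ i ∈ S, F (Function.update (θ • y) i 0) ^ q) 0 :=
        lmarginal_mono (hF.mul_zero_rpow_le_prod hS) 0
    _ = ENNReal.ofReal θ⁻¹ ^ S.card
        * integrateOut S (fun y => ∏ i ∈ S, F (Function.update y i 0) ^ q) 0 := by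
        rw [integrateOut_comp_smul (F := fun y => ∏ i ∈ S, F (Function.update y i 0) ^ q)
          (Finset.measurable_fun_prod _ fun i _ => (hm i).pow_const _) hθ, smul_zero]
    _ ≤ ENNReal.ofReal θ⁻¹ ^ S.card
        * ∏ i ∈ S, integrateOut (S.erase i) (fun y => F (Function.update y i 0)) 0 ^ q := by
        gcongr
        refine lmarginal_prod_rpow_le hS hm (fun i y z h => congrArg F ?_) subset_rfl 0
        ext j
        rcases eq_or_ne j i with rfl | hj
        · simp
        · simp [hj, h j (by simpa using hj)]
    _ = _ := by
        congr! 3 with i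
        have h := lmarginal_update_of_notMem (μ := fun _ : ι => halfLine) hF.measurable
          (Finset.notMem_erase i S) 0 0
        rwa [Function.update_eq_self_iff.2 (by simp), eq_comm] at h

/-- A functional Loomis–Whitney inequality for log-concave antitone functions, with the sections
through the origin in place of the projections. -/
theorem zero_mul_pow_le (hF : IsOrthantLogConcave F) (hS : S.Nonempty) :
    F 0 * integrateOut S F 0 ^ (S.card - 1)
      ≤ ENNReal.ofReal (Real.exp 1) ^ S.card * ∏ i ∈ S, integrateOut (S.erase i) F 0 := by
  rcases (Nat.one_le_iff_ne_zero.2 hS.card_ne_zero).eq_or_lt with hk | hk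
  · obtain ⟨i, rfl⟩ := Finset.card_eq_one.1 hk.symm
    have one_le : 1 ≤ ENNReal.ofReal (Real.exp 1) :=
      ENNReal.one_le_ofReal.2 (Real.one_le_exp zero_le_one)
    simpa using mul_le_mul_left one_le (F 0)
  have rpow_pow (c : ℝ≥0∞) : (c ^ (1 / (S.card - 1 : ℝ))) ^ (S.card - 1) = c := by
    have : (2 : ℝ) ≤ S.card := mod_cast hk
    rw [← ENNReal.rpow_mul_natCast, Nat.cast_sub (by omega), Nat.cast_one,
      one_div_mul_cancel (by linarith), ENNReal.rpow_one]
  calc F 0 * integrateOut S F 0 ^ (S.card - 1)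
      = (integrateOut S F 0 * F 0 ^ (1 / (S.card - 1 : ℝ))) ^ (S.card - 1) := by
        rw [mul_pow, rpow_pow, mul_comm]
    _ ≤ (ENNReal.ofReal (((S.card - 1 : ℝ) / S.card)⁻¹) ^ S.card
        * ∏ i ∈ S, integrateOut (S.erase i) F 0 ^ (1 / (S.card - 1 : ℝ))) ^ (S.card - 1) := by
        exact pow_le_pow_left' (hF.integrateOut_mul_zero_rpow_le hk) _
    _ = ENNReal.ofReal ((((S.card - 1 : ℝ) / S.card)⁻¹) ^ (S.card - 1)) ^ S.card
        * ∏ i ∈ S, integrateOut (S.erase i) F 0 := by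
        have : (1 : ℝ) ≤ S.card := mod_cast hk.le
        rw [mul_pow, ← Finset.prod_pow, pow_right_comm, ENNReal.ofReal_pow
          (inv_nonneg.2 (div_nonneg (by linarith) (by linarith)))]
        simp_rw [rpow_pow]
    _ ≤ _ := by
        gcongr
        exact inv_one_sub_inv_pow_le_exp hk

end IsOrthantLogConcave

end LoomisWhitney

section OneVariable

theorem lintegral_halfLine_eq_Ioi (ψ : ℝ → ℝ≥0∞) :
    ∫⁻ r, ψ r ∂halfLine = ∫⁻ r in Set.Ioi 0, ψ r :=
  (setLIntegral_congr Ioi_ae_eq_Ici).symm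

theorem setLIntegral_halfLine_Ioi (ψ : ℝ → ℝ≥0∞) {t : ℝ} (ht : 0 ≤ t) :
    ∫⁻ r in Set.Ioi t, ψ r ∂halfLine = ∫⁻ r in Set.Ioi t, ψ r := by
  rw [halfLine, Measure.restrict_restrict measurableSet_Ioi,
    Set.inter_eq_left.2 (Set.Ioi_subset_Ici ht)]

theorem lintegral_halfLine_indicator_Ioc (ψ : ℝ → ℝ≥0∞) (c : ℝ) :
    ∫⁻ r, (Set.Ioc 0 c).indicator ψ r ∂halfLine = ∫⁻ r in Set.Ioc 0 c, ψ r := by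
  rw [lintegral_indicator measurableSet_Ioc, halfLine, Measure.restrict_restrict measurableSet_Ioc,
    Set.inter_eq_left.2 (Set.Ioc_subset_Icc_self.trans Set.Icc_subset_Ici_self)]

theorem setLIntegral_Ioc_add_Ioi (ψ : ℝ → ℝ≥0∞) {a b : ℝ} (hab : a ≤ b) :
    (∫⁻ r in Set.Ioc a b, ψ r) + ∫⁻ r in Set.Ioi b, ψ r = ∫⁻ r in Set.Ioi a, ψ r := by
  rw [← lintegral_union measurableSet_Ioi (Set.disjoint_left.2 fun r h1 h2 =>
    not_lt_of_ge h1.2 h2), Set.Ioc_union_Ioi_eq_Ioi hab]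

theorem setLIntegral_comp_add_right (ψ : ℝ → ℝ≥0∞) {A B : Set ℝ} (s : ℝ)
    (hA : MeasurableSet A) (hB : MeasurableSet B) (hAB : ∀ r, r ∈ A ↔ r + s ∈ B) :
    ∫⁻ r in A, ψ (r + s) = ∫⁻ r in B, ψ r := by
  rw [← lintegral_indicator hA, ← lintegral_indicator hB,
    ← lintegral_add_right_eq_self (B.indicator ψ) s]
  refine lintegral_congr fun r => ?_
  by_cases h : r ∈ A
  · rw [Set.indicator_of_mem h, Set.indicator_of_mem ((hAB r).1 h)]
  · rw [Set.indicator_of_notMem h, Set.indicator_of_notMem (fun h' => h ((hAB r).2 h'))]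

theorem one_sub_mul_le_of_le_mul {u v c : ℝ≥0∞} (hfin : u + v ≠ ∞) (h : v ≤ c * (u + v)) :
    (1 - c) * (u + v) ≤ u := by
  rw [ENNReal.sub_mul fun _ _ => hfin, one_mul, tsub_le_iff_right]
  exact add_le_add_right h u

theorem le_one_sub_mul_of_mul_le {u v c : ℝ≥0∞} (hfin : u + v ≠ ∞) (h : c * (u + v) ≤ u) :
    v ≤ (1 - c) * (u + v) := by
  rw [ENNReal.sub_mul fun _ _ => hfin, one_mul]
  exact (ENNReal.le_sub_of_add_le_left (ne_top_of_le_ne_top hfin (h.trans le_self_add))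
    (add_le_add_left h v))

variable {ψ : ℝ → ℝ≥0∞}

theorem mul_setLIntegral_Ioc_le_of_antitone (hψ : Antitone ψ) {d D : ℝ} (hd : 0 < d)
    (hdD : d ≤ D) :
    ENNReal.ofReal (d / D) * ∫⁻ r in Set.Ioc 0 D, ψ r ≤ ∫⁻ r in Set.Ioc 0 d, ψ r := by
  have hD : 0 < D := hd.trans_le hdD
  have hθ : 0 < D / d := by positivity
  have hscale := lintegral_halfLine_comp_mul (hψ.measurable.indicator measurableSet_Ioc)
    (h := (Set.Ioc 0 D).indicator ψ) hθ
  rw [inv_div, lintegral_halfLine_indicator_Ioc] at hscale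
  rw [← hscale, ← lintegral_halfLine_indicator_Ioc]
  refine lintegral_mono_ae ?_
  filter_upwards [ae_halfLine_nonneg] with r hr
  by_cases h : D / d * r ∈ Set.Ioc 0 D
  · have hr' : r ∈ Set.Ioc 0 d := by
      refine ⟨(mul_pos_iff_of_pos_left hθ).1 h.1, ?_⟩
      have := h.2
      rw [div_mul_eq_mul_div, div_le_iff₀ hd] at this
      exact le_of_mul_le_mul_left this hD
    rw [Set.indicator_of_mem h, Set.indicator_of_mem hr']
    exact hψ (le_mul_of_one_le_left hr ((one_le_div hd).2 hdD))
  · rw [Set.indicator_of_notMem h]; exact zero_le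

theorem setLIntegral_Ioi_two_mul_le (hψ : Measurable ψ) {M : ℝ} (hM : 0 < M)
    (h2 : ∫⁻ r, ENNReal.ofReal (r ^ 2) * ψ r ∂halfLine
      ≤ ENNReal.ofReal (M ^ 2) * ∫⁻ r, ψ r ∂halfLine) :
    ∫⁻ r in Set.Ioi (2 * M), ψ r ≤ 4⁻¹ * ∫⁻ r in Set.Ioi 0, ψ r := by
  rw [← ENNReal.mul_le_mul_iff_right (a := ENNReal.ofReal ((2 * M) ^ 2))
    (ENNReal.ofReal_pos.2 (by positivity)).ne' ENNReal.ofReal_ne_top]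
  calc ENNReal.ofReal ((2 * M) ^ 2) * ∫⁻ r in Set.Ioi (2 * M), ψ r
      = ∫⁻ r in Set.Ioi (2 * M), ENNReal.ofReal ((2 * M) ^ 2) * ψ r :=
        (lintegral_const_mul _ hψ).symm
    _ ≤ ∫⁻ r in Set.Ioi (2 * M), ENNReal.ofReal (r ^ 2) * ψ r := by
        refine setLIntegral_mono' measurableSet_Ioi fun r hr => ?_
        gcongr
        exact hr.le
    _ ≤ ∫⁻ r in Set.Ioi 0, ENNReal.ofReal (r ^ 2) * ψ r :=
        lintegral_mono_set (Set.Ioi_subset_Ioi (by positivity))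
    _ ≤ ENNReal.ofReal (M ^ 2) * ∫⁻ r in Set.Ioi 0, ψ r := by
        simpa only [lintegral_halfLine_eq_Ioi] using h2
    _ = ENNReal.ofReal ((2 * M) ^ 2) * (4⁻¹ * ∫⁻ r in Set.Ioi 0, ψ r) := by
        rw [← mul_assoc, mul_pow, mul_comm (2 ^ 2), ENNReal.ofReal_mul (by positivity),
          show ENNReal.ofReal (2 ^ 2) = 4 by norm_num, mul_assoc (ENNReal.ofReal _),
          ENNReal.mul_inv_cancel (by norm_num) (by norm_num), mul_one]

theorem setLIntegral_Ioi_le_of_le_two_mul (hψ : Antitone ψ) {M d : ℝ} (hM : 0 < M)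
    (hd : 0 < d) (hdM : d ≤ 2 * M)
    (h2 : ∫⁻ r, ENNReal.ofReal (r ^ 2) * ψ r ∂halfLine
      ≤ ENNReal.ofReal (M ^ 2) * ∫⁻ r, ψ r ∂halfLine) :
    ∫⁻ r in Set.Ioi d, ψ r
      ≤ ENNReal.ofReal (Real.exp (-(3 / 8 * (d / M)))) * ∫⁻ r in Set.Ioi 0, ψ r := by
  rcases eq_or_ne (∫⁻ r in Set.Ioi 0, ψ r) ∞ with hI | hI
  · rw [hI, ENNReal.mul_top (by simp [Real.exp_pos])]; exact le_top
  have hsplit_d := setLIntegral_Ioc_add_Ioi ψ hd.le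
  have hsplit_M := setLIntegral_Ioc_add_Ioi ψ (by positivity : 0 ≤ 2 * M)
  have hmass : (1 - 4⁻¹) * ∫⁻ r in Set.Ioi 0, ψ r ≤ ∫⁻ r in Set.Ioc 0 (2 * M), ψ r := by
    rw [← hsplit_M] at hI ⊢
    exact one_sub_mul_le_of_le_mul hI
      (hsplit_M ▸ setLIntegral_Ioi_two_mul_le hψ.measurable hM h2)
  have hcoef : ENNReal.ofReal (3 / 8 * (d / M)) = ENNReal.ofReal (d / (2 * M)) * (1 - 4⁻¹) := by
    have : (1 - 4⁻¹ : ℝ≥0∞) = ENNReal.ofReal (3 / 4) := by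
      rw [show (3 / 4 : ℝ) = 1 - 4⁻¹ by norm_num, ENNReal.ofReal_sub _ (by norm_num),
        ENNReal.ofReal_inv_of_pos (by norm_num)]
      norm_num
    rw [this, ← ENNReal.ofReal_mul (by positivity)]
    congr 1; field_simp; norm_num
  have hscale : ENNReal.ofReal (3 / 8 * (d / M)) * ∫⁻ r in Set.Ioi 0, ψ r
      ≤ ∫⁻ r in Set.Ioc 0 d, ψ r := by
    rw [hcoef, mul_assoc]
    exact (mul_le_mul_right hmass _).trans (mul_setLIntegral_Ioc_le_of_antitone hψ hd hdM)
  calc ∫⁻ r in Set.Ioi d, ψ r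
      ≤ (1 - ENNReal.ofReal (3 / 8 * (d / M))) * ∫⁻ r in Set.Ioi 0, ψ r := by
        rw [← hsplit_d] at hI hscale ⊢
        exact le_one_sub_mul_of_mul_le hI hscale
    _ ≤ _ := by
        rw [← ENNReal.ofReal_one, ← ENNReal.ofReal_sub _ (by positivity)]
        gcongr
        exact Real.one_sub_le_exp_neg _

namespace IsLogConcaveAntitone

theorem mul_le_mul_shift (hψ : IsLogConcaveAntitone ψ) {x y d : ℝ} (hxy : y ≤ x) (hd : 0 ≤ d) :
    ψ (x + d) * ψ y ≤ ψ x * ψ (y + d) := by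
  rcases hxy.eq_or_lt with rfl | hxy
  · rw [mul_comm]
  rcases hd.eq_or_lt with rfl | hd
  · simp
  -- `x` and `y + d` are the two mirror-image convex combinations of `y` and `x + d`.
  have hL : 0 < x + d - y := by linarith
  set α := d / (x + d - y) with hα
  set β := (x - y) / (x + d - y) with hβ
  have hα0 : 0 < α := div_pos hd hL
  have hβ0 : 0 < β := div_pos (by linarith) hL
  have hαβ : α + β = 1 := by rw [hα, hβ]; field_simp; ring
  have hx : α • y + β • (x + d) = x := by
    simp only [hα, hβ, smul_eq_mul]; field_simp; ring
  have hyd : β • y + α • (x + d) = y + d := by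
    simp only [hα, hβ, smul_eq_mul]; field_simp; ring
  calc ψ (x + d) * ψ y = ψ (x + d) ^ (α + β) * ψ y ^ (α + β) := by simp [hαβ]
    _ = ψ y ^ α * ψ (x + d) ^ β * (ψ y ^ β * ψ (x + d) ^ α) := by
        rw [ENNReal.rpow_add_of_nonneg _ _ hα0.le hβ0.le,
          ENNReal.rpow_add_of_nonneg _ _ hα0.le hβ0.le]
        ring
    _ ≤ ψ x * ψ (y + d) := by
        gcongr
        · exact (hψ.logConcave y (x + d) α β hα0 hβ0 hαβ).trans_eq (by rw [hx])
        · exact (hψ.logConcave y (x + d) β α hβ0 hα0 (by linarith)).trans_eq (by rw [hyd])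

theorem setLIntegral_Ioi_add_mul_le (hψ : IsLogConcaveAntitone ψ) {s t : ℝ} (hs : 0 ≤ s)
    (ht : 0 ≤ t) :
    (∫⁻ r in Set.Ioi (s + t), ψ r) * (∫⁻ r in Set.Ioi 0, ψ r)
      ≤ (∫⁻ r in Set.Ioi t, ψ r) * ∫⁻ r in Set.Ioi s, ψ r := by
  have hm : Measurable ψ := hψ.antitone.measurable
  have hms : Measurable fun r => ψ (r + s) := hm.comp (measurable_add_const s)
  have shift_Ioi : ∫⁻ r in Set.Ioi t, ψ (r + s) = ∫⁻ r in Set.Ioi (s + t), ψ r :=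
    setLIntegral_comp_add_right ψ s measurableSet_Ioi measurableSet_Ioi fun r => by
      simp only [Set.mem_Ioi]; constructor <;> intro h <;> linarith
  have shift_Ioc : ∫⁻ r in Set.Ioc 0 t, ψ (r + s) = ∫⁻ r in Set.Ioc s (s + t), ψ r :=
    setLIntegral_comp_add_right ψ s measurableSet_Ioc measurableSet_Ioc fun r => by
      simp only [Set.mem_Ioc]; constructor <;> intro h <;> constructor <;> linarith [h.1, h.2]
  have hinitial : (∫⁻ r in Set.Ioi (s + t), ψ r) * (∫⁻ r in Set.Ioc 0 t, ψ r)
      ≤ (∫⁻ r in Set.Ioi t, ψ r) * ∫⁻ r in Set.Ioc s (s + t), ψ r := by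
    rw [← shift_Ioi, ← shift_Ioc, ← lintegral_mul_const _ hms, ← lintegral_mul_const _ hm]
    refine setLIntegral_mono' measurableSet_Ioi fun x hx => ?_
    rw [← lintegral_const_mul _ hm, ← lintegral_const_mul _ hms]
    exact setLIntegral_mono' measurableSet_Ioc fun y hy =>
      hψ.mul_le_mul_shift (hy.2.trans (le_of_lt hx)) hs
  rw [← setLIntegral_Ioc_add_Ioi ψ ht,
    ← setLIntegral_Ioc_add_Ioi ψ (le_add_of_nonneg_right ht : s ≤ s + t), mul_add, mul_add]
  exact add_le_add hinitial (mul_comm _ _).le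

theorem setLIntegral_Ioi_nat_mul_le (hψ : IsLogConcaveAntitone ψ) {d : ℝ} (hd : 0 ≤ d)
    {q : ℝ≥0∞} (hq : q ≠ 0)
    (h : ∫⁻ r in Set.Ioi d, ψ r ≤ q * ∫⁻ r in Set.Ioi 0, ψ r) (m : ℕ) :
    ∫⁻ r in Set.Ioi (m * d), ψ r ≤ q ^ m * ∫⁻ r in Set.Ioi 0, ψ r := by
  rcases eq_or_ne (∫⁻ r in Set.Ioi 0, ψ r) ∞ with hI | hI
  · rw [hI, ENNReal.mul_top (pow_ne_zero _ hq)]; exact le_top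
  rcases eq_or_ne (∫⁻ r in Set.Ioi 0, ψ r) 0 with h0 | h0
  · refine (lintegral_mono_set (Set.Ioi_subset_Ioi (by positivity))).trans ?_
    rw [h0]; exact zero_le
  induction m with
  | zero => simp
  | succ m ih =>
    rw [show ((m + 1 : ℕ) : ℝ) * d = m * d + d by push_cast; ring,
      ← ENNReal.mul_le_mul_iff_left h0 hI]
    refine (hψ.setLIntegral_Ioi_add_mul_le (s := m * d) (t := d) (by positivity) hd).trans ?_
    exact (mul_le_mul' h ih).trans_eq (by ring)

-- Mass and second moment already give `∫_{r > d} ψ ≤ exp (-3 d / (8 M)) ∫ ψ` for `d ≤ 2 M`;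
-- log-concavity of the tail carries this over from `d = p / m` to `p`.
theorem setLIntegral_Ioi_le_exp (hψ : IsLogConcaveAntitone ψ) {M p : ℝ} (hM : 0 < M) (hp : 0 < p)
    (h2 : ∫⁻ r, ENNReal.ofReal (r ^ 2) * ψ r ∂halfLine
      ≤ ENNReal.ofReal (M ^ 2) * ∫⁻ r, ψ r ∂halfLine) :
    ∫⁻ r in Set.Ioi p, ψ r ∂halfLine
      ≤ ENNReal.ofReal (Real.exp (-(3 / 8 * (p / M)))) * ∫⁻ r, ψ r ∂halfLine := by
  obtain ⟨m, hm⟩ := exists_nat_gt (p / (2 * M))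
  have hm0 : (0 : ℝ) < m := lt_trans (by positivity) hm
  have hd : p / m ≤ 2 * M := by
    rw [div_lt_iff₀ (by positivity)] at hm
    rw [div_le_iff₀ hm0]
    linarith
  have h := hψ.setLIntegral_Ioi_nat_mul_le (div_pos hp hm0).le (by simp [Real.exp_pos])
    (setLIntegral_Ioi_le_of_le_two_mul hψ.antitone hM (div_pos hp hm0) hd h2) m
  rw [mul_div_cancel₀ _ hm0.ne', ← ENNReal.ofReal_pow (Real.exp_pos _).le, ← Real.exp_nat_mul] at h
  rw [setLIntegral_halfLine_Ioi _ hp.le, lintegral_halfLine_eq_Ioi]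
  convert h using 4
  field_simp

end IsLogConcaveAntitone

theorem lintegral_pow_mul_exp (k : ℕ) {c : ℝ} (hc : 0 < c) :
    ∫⁻ r, ENNReal.ofReal (r ^ k * Real.exp (-(c * r))) ∂halfLine
      = ENNReal.ofReal (k.factorial / c ^ (k + 1)) := by
  have hgamma : ∫⁻ r, ENNReal.ofReal (c ^ (k + 1) / k.factorial)
      * ENNReal.ofReal (r ^ k * Real.exp (-(c * r))) ∂halfLine = 1 := by
    rw [← ProbabilityTheory.lintegral_gammaPDF_eq_one (a := k + 1) (by positivity) hc, halfLine,
      ← lintegral_indicator measurableSet_Ici]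
    refine lintegral_congr fun r => ?_
    by_cases hr : r ∈ Set.Ici (0 : ℝ)
    · rw [Set.indicator_of_mem hr, ProbabilityTheory.gammaPDF_of_nonneg hr,
        ← ENNReal.ofReal_mul (by positivity), Real.Gamma_nat_eq_factorial, add_sub_cancel_right,
        Real.rpow_natCast, ← Nat.cast_add_one, Real.rpow_natCast, mul_assoc]
    · rw [Set.indicator_of_notMem hr, ProbabilityTheory.gammaPDF_of_neg (not_le.1 hr)]
  rw [lintegral_const_mul' _ _ ENNReal.ofReal_ne_top] at hgamma
  rw [← inv_div, ENNReal.ofReal_inv_of_pos (by positivity)]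
  exact ENNReal.eq_inv_of_mul_eq_one_left (by rwa [mul_comm])

namespace IsLogConcaveAntitone

theorem ofReal_mul_exp_le_of_le (hψ : IsLogConcaveAntitone ψ) {a : ℝ} (ha : 0 ≤ a)
    (h0 : ENNReal.ofReal a ≤ ψ 0) {r s : ℝ} (hr : 0 ≤ r) (hrs : r ≤ s)
    (hs : ENNReal.ofReal (a * Real.exp (-(a * s))) ≤ ψ s) :
    ENNReal.ofReal (a * Real.exp (-(a * r))) ≤ ψ r := by
  rcases hr.eq_or_lt with rfl | hr
  · simpa using h0
  rcases hrs.eq_or_lt with rfl | hrs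
  · exact hs
  have hs0 : 0 < s := hr.trans hrs
  have hθ0 : 0 < r / s := div_pos hr hs0
  have hθ1 : 0 < 1 - r / s := sub_pos.2 ((div_lt_one hs0).2 hrs)
  calc ENNReal.ofReal (a * Real.exp (-(a * r)))
      = ENNReal.ofReal a ^ (1 - r / s) * ENNReal.ofReal (a * Real.exp (-(a * s))) ^ (r / s) := by
        rw [ENNReal.ofReal_mul ha, ENNReal.ofReal_mul ha, ENNReal.mul_rpow_of_nonneg _ _ hθ0.le,
          ← mul_assoc, ← ENNReal.rpow_add_of_nonneg _ _ hθ1.le hθ0.le, sub_add_cancel,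
          ENNReal.rpow_one, ENNReal.ofReal_rpow_of_pos (Real.exp_pos _), ← Real.exp_mul]
        congr 4
        field_simp
    _ ≤ ψ 0 ^ (1 - r / s) * ψ s ^ (r / s) := by gcongr
    _ ≤ ψ ((1 - r / s) • 0 + (r / s) • s) := hψ.logConcave 0 s _ _ hθ1 hθ0 (sub_add_cancel _ _)
    _ = ψ r := by rw [smul_zero, zero_add, smul_eq_mul, div_mul_cancel₀ _ hs0.ne']

end IsLogConcaveAntitone

theorem lintegral_mul_le_of_crossing {α : Type*} [MeasurableSpace α] {μ : Measure α}
    {w φ ψ : α → ℝ≥0∞} {c : ℝ≥0∞} (hφ : Measurable φ) (hψ : Measurable ψ)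
    (hc : c ≠ ∞) (hfin : ∫⁻ r, φ r ∂μ ≠ ∞) (heq : ∫⁻ r, ψ r ∂μ = ∫⁻ r, φ r ∂μ)
    (hcross : ∀ᵐ r ∂μ, w r ≤ c ∧ φ r ≤ ψ r ∨ c ≤ w r ∧ ψ r ≤ φ r) :
    ∫⁻ r, w r * ψ r ∂μ ≤ ∫⁻ r, w r * φ r ∂μ := by
  have hint : ∫⁻ r, w r * ψ r + c * φ r ∂μ ≤ ∫⁻ r, w r * φ r + c * ψ r ∂μ := by
    refine lintegral_mono_ae (hcross.mono fun r hr => ?_)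
    rcases hr with ⟨h1, h2⟩ | ⟨h1, h2⟩ <;>
      obtain ⟨u, hu⟩ := exists_add_of_le h1 <;> obtain ⟨v, hv⟩ := exists_add_of_le h2 <;>
      rw [hu, hv] <;> ring_nf <;> simp
  rw [lintegral_add_right _ (hφ.const_mul c), lintegral_add_right _ (hψ.const_mul c),
    lintegral_const_mul c hφ, lintegral_const_mul c hψ, heq] at hint
  exact (ENNReal.add_le_add_iff_right (ENNReal.mul_ne_top hc hfin)).1 hint

theorem lintegral_pow_mul_expDensity (k : ℕ) {a : ℝ} (ha : 0 < a) :
    ∫⁻ r, ENNReal.ofReal (r ^ k) * ENNReal.ofReal (a * Real.exp (-(a * r))) ∂halfLine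
      = ENNReal.ofReal (k.factorial / a ^ k) := by
  rw [show (k.factorial / a ^ k : ℝ) = a * (k.factorial / a ^ (k + 1)) by
      rw [pow_succ]; field_simp,
    ENNReal.ofReal_mul ha.le, ← lintegral_pow_mul_exp k ha,
    ← lintegral_const_mul' _ _ ENNReal.ofReal_ne_top]
  refine lintegral_congr_ae ?_
  filter_upwards [ae_halfLine_nonneg] with r hr
  rw [← ENNReal.ofReal_mul (by positivity), ← ENNReal.ofReal_mul ha.le]
  congr 1; ring

namespace IsLogConcaveAntitone

-- Among log-concave decreasing densities with value at least `a` at the origin, the exponential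
-- density `a * exp (-a r)` has the largest second moment: `ψ` lies above it up to some `R` and
-- below it afterwards.
theorem lintegral_sq_mul_le (hψ : IsLogConcaveAntitone ψ) (h1 : ∫⁻ r, ψ r ∂halfLine = 1)
    {a : ℝ} (ha : 0 < a) (h0 : ENNReal.ofReal a ≤ ψ 0) :
    ∫⁻ r, ENNReal.ofReal (r ^ 2) * ψ r ∂halfLine ≤ ENNReal.ofReal (2 / a ^ 2) := by
  set φ : ℝ → ℝ≥0∞ := fun r => ENNReal.ofReal (a * Real.exp (-(a * r)))
  have hφm : Measurable φ := by fun_prop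
  have hφ1 : ∫⁻ r, φ r ∂halfLine = 1 := by simpa using lintegral_pow_mul_expDensity 0 ha
  have hφ2 : ∫⁻ r, ENNReal.ofReal (r ^ 2) * φ r ∂halfLine = ENNReal.ofReal (2 / a ^ 2) := by
    simpa using lintegral_pow_mul_expDensity 2 ha
  rw [← hφ2]
  by_cases hbdd : BddAbove {r | φ r ≤ ψ r}
  · have hmem : (0 : ℝ) ∈ {r | φ r ≤ ψ r} := by simpa [φ] using h0
    have hR : 0 ≤ sSup {r | φ r ≤ ψ r} := le_csSup hbdd hmem
    refine lintegral_mul_le_of_crossing (c := ENNReal.ofReal (sSup {r | φ r ≤ ψ r} ^ 2))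
      hφm hψ.antitone.measurable ENNReal.ofReal_ne_top (by simp [hφ1])
      (h1.trans hφ1.symm) ?_
    filter_upwards [ae_halfLine_nonneg] with r hr
    rcases lt_or_ge r (sSup {r | φ r ≤ ψ r}) with hlt | hge
    · obtain ⟨s, hs, hrs⟩ := exists_lt_of_lt_csSup ⟨0, hmem⟩ hlt
      exact .inl ⟨by gcongr, hψ.ofReal_mul_exp_le_of_le ha.le h0 hr hrs.le hs⟩
    rcases le_total (φ r) (ψ r) with hle | hle
    · exact .inl ⟨by gcongr; exact le_csSup hbdd hle, hle⟩
    · exact .inr ⟨by gcongr, hle⟩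
  · have hle : φ ≤ᵐ[halfLine] ψ := by
      filter_upwards [ae_halfLine_nonneg] with r hr
      obtain ⟨s, hs, hrs⟩ := not_bddAbove_iff.1 hbdd r
      exact hψ.ofReal_mul_exp_le_of_le ha.le h0 hr hrs.le hs
    have heq : φ =ᵐ[halfLine] ψ := ae_eq_of_ae_le_of_lintegral_le hle (by simp [hφ1])
      hψ.antitone.measurable.aemeasurable (by rw [h1, hφ1])
    exact (lintegral_congr_ae (heq.mono fun r hr => by rw [hr])).ge

theorem zero_le_of_le_secondMoment (hψ : IsLogConcaveAntitone ψ)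
    (h1 : ∫⁻ r, ψ r ∂halfLine = 1) {σ : ℝ} (hσ : 0 < σ)
    (h2 : ENNReal.ofReal (σ ^ 2) ≤ ∫⁻ r, ENNReal.ofReal (r ^ 2) * ψ r ∂halfLine) :
    ψ 0 ≤ ENNReal.ofReal (2 / σ) := by
  refine ENNReal.le_of_forall_nnreal_lt fun a ha => ?_
  rcases eq_or_ne a 0 with rfl | ha0
  · exact zero_le
  have ha0 : (0 : ℝ) < a := NNReal.coe_pos.2 (pos_iff_ne_zero.2 ha0)
  have hσa : σ ^ 2 ≤ 2 / (a : ℝ) ^ 2 := (ENNReal.ofReal_le_ofReal_iff (by positivity)).1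
    (h2.trans (hψ.lintegral_sq_mul_le h1 ha0 (by simpa using ha.le)))
  rw [le_div_iff₀ (by positivity), ← mul_pow] at hσa
  rw [← ENNReal.ofReal_coe_nnreal]
  refine ENNReal.ofReal_le_ofReal ((le_div_iff₀ hσ).2 ?_)
  nlinarith

end IsLogConcaveAntitone

end OneVariable

section Marginals

/-- Lebesgue measure on `[0,∞)^ι`, as a measure on `ι → ℝ`. -/
noncomputable abbrev orthantVolume (ι : Type*) [Fintype ι] : Measure (ι → ℝ) :=
  Measure.pi fun _ => halfLine

variable {ι : Type*} [DecidableEq ι] {F : (ι → ℝ) → ℝ≥0∞}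

theorem integrateOut_indicator_of_dependsOn {s : Finset ι} (hF : Measurable F) {E : Set (ι → ℝ)}
    (hE : DependsOn (· ∈ E) {i | i ∉ s}) :
    integrateOut s (E.indicator F) = E.indicator (integrateOut s F) := by
  have indicator_eq (G : (ι → ℝ) → ℝ≥0∞) :
      E.indicator G = fun x => E.indicator (1 : (ι → ℝ) → ℝ≥0∞) x * G x := by
    ext x; by_cases hx : x ∈ E <;> simp [hx]
  rw [indicator_eq F, indicator_eq (integrateOut s F)]
  refine funext fun x => integrateOut_mul_of_dependsOn hF (fun y z h => ?_) x
  have hyz : y ∈ E ↔ z ∈ E := eq_iff_iff.1 (hE h)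
  by_cases hz : z ∈ E
  · rw [Set.indicator_of_mem hz, Set.indicator_of_mem (hyz.2 hz)]; rfl
  · rw [Set.indicator_of_notMem hz, Set.indicator_of_notMem (hz ∘ hyz.1)]

theorem integrateOut_indicator_pi_const (S : Finset ι) {B : Set ℝ} (hB : MeasurableSet B)
    (c : ℝ≥0∞) (x : ι → ℝ) :
    integrateOut S (((S : Set ι).pi fun _ => B).indicator fun _ => c) x
      = halfLine B ^ S.card * c := by
  have hbox : ∀ y : S → ℝ, ((S : Set ι).pi fun _ => B).indicator (fun _ => c)
      (Function.updateFinset x S y) = (Set.univ.pi fun _ => B).indicator (fun _ => c) y := by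
    intro y
    refine Set.indicator_const_eq_indicator_const ?_
    simp +contextual [Set.mem_pi, Function.updateFinset]
  simp_rw [integrateOut, lmarginal, hbox]
  rw [lintegral_indicator_const (MeasurableSet.univ_pi fun _ => hB), Measure.pi_pi,
    Finset.prod_const, Finset.card_univ, Fintype.card_coe, mul_comm]

variable [Fintype ι]

theorem lintegral_orthantVolume_eq_integrateOut (hF : Measurable F) (S : Finset ι) (x : ι → ℝ) :
    ∫⁻ y, F y ∂orthantVolume ι = integrateOut S (integrateOut Sᶜ F) x := by
  rw [lintegral_eq_lmarginal_univ (μ := fun _ : ι => halfLine) x, ← Finset.union_compl S]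
  exact congrFun (integrateOut_union hF disjoint_compl_right) x

theorem setLIntegral_orthantVolume_eq_integrateOut (hF : Measurable F) {E : Set (ι → ℝ)}
    (hEm : MeasurableSet E) {S : Finset ι} (hE : DependsOn (· ∈ E) S) :
    ∫⁻ x in E, F x ∂orthantVolume ι = integrateOut S (E.indicator (integrateOut Sᶜ F)) 0 := by
  rw [← lintegral_indicator hEm, lintegral_orthantVolume_eq_integrateOut (hF.indicator hEm) S 0,
    integrateOut_indicator_of_dependsOn hF (by simpa using hE)]

theorem integrateOut_compl_mul_eq_lintegral {e : ι} {U : Finset ι} (he : e ∉ U)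
    (hF : Measurable F) {k : ℝ → ℝ≥0∞} (hk : Measurable k) (x : ι → ℝ) :
    integrateOut Uᶜ (fun y => k (y e) * F y) x
      = ∫⁻ r, k r * integrateOut (insert e U)ᶜ F (Function.update x e r) ∂halfLine := by
  have hU : Uᶜ = insert e (insert e U)ᶜ := by
    rw [Finset.insert_compl_insert he]
  rw [hU, integrateOut_insert (F := fun y => k (y e) * F y)
    ((hk.comp (measurable_pi_apply e)).mul hF) (by simp)]
  refine lintegral_congr fun r => ?_
  rw [integrateOut_mul_of_dependsOn (A := fun y => k (y e)) hF
    (fun y z h => congrArg k (h e (by simp))), Function.update_self]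

theorem integrateOut_compl_eq_lintegral {e : ι} {U : Finset ι} (he : e ∉ U)
    (hF : Measurable F) (x : ι → ℝ) :
    integrateOut Uᶜ F x
      = ∫⁻ r, integrateOut (insert e U)ᶜ F (Function.update x e r) ∂halfLine := by
  simpa using integrateOut_compl_mul_eq_lintegral (k := fun _ => 1) he hF measurable_const x

theorem lintegral_coord_mul_orthantVolume (e : ι) (hF : Measurable F) {k : ℝ → ℝ≥0∞}
    (hk : Measurable k) :
    ∫⁻ x, k (x e) * F x ∂orthantVolume ι
      = ∫⁻ r, k r * integrateOut {e}ᶜ F (Function.update 0 e r) ∂halfLine := by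
  rw [lintegral_eq_lmarginal_univ (μ := fun _ : ι => halfLine) 0, ← Finset.compl_empty]
  exact integrateOut_compl_mul_eq_lintegral (Finset.notMem_empty e) hF hk 0

namespace IsOrthantLogConcave

theorem integrateOut_compl_singleton_zero_le (hF : IsOrthantLogConcave F)
    (h1 : ∫⁻ x, F x ∂orthantVolume ι = 1) {σ : ℝ} (hσ : 0 < σ) {i : ι}
    (h2 : ENNReal.ofReal (σ ^ 2) ≤ ∫⁻ x, ENNReal.ofReal (x i ^ 2) * F x ∂orthantVolume ι) :
    integrateOut {i}ᶜ F 0 ≤ ENNReal.ofReal (2 / σ) := by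
  rw [lintegral_coord_mul_orthantVolume (k := fun r => ENNReal.ofReal (r ^ 2)) i hF.measurable
    (by fun_prop)] at h2
  have hmass := lintegral_coord_mul_orthantVolume (k := fun _ => 1) i hF.measurable
    measurable_const
  simp only [one_mul, h1] at hmass
  simpa using ((isOrthantLogConcave_integrateOut hF {i}ᶜ).slice 0 i).zero_le_of_le_secondMoment
    hmass.symm hσ h2

theorem integrateOut_compl_zero_le (hF : IsOrthantLogConcave F)
    (h1 : ∫⁻ x, F x ∂orthantVolume ι = 1) {S : Finset ι} (hS : S.Nonempty) {σ : ℝ} (hσ : 0 < σ)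
    (h2 : ∀ i ∈ S,
      ENNReal.ofReal (σ ^ 2) ≤ ∫⁻ x, ENNReal.ofReal (x i ^ 2) * F x ∂orthantVolume ι) :
    integrateOut Sᶜ F 0 ≤ ENNReal.ofReal (2 * Real.exp 1 / σ) ^ S.card := by
  have hLW := (isOrthantLogConcave_integrateOut hF Sᶜ).zero_mul_pow_le hS
  rw [← lintegral_orthantVolume_eq_integrateOut hF.measurable, h1, one_pow, mul_one] at hLW
  calc integrateOut Sᶜ F 0
      ≤ ENNReal.ofReal (Real.exp 1) ^ S.card
        * ∏ i ∈ S, integrateOut (S.erase i) (integrateOut Sᶜ F) 0 := hLW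
    _ ≤ ENNReal.ofReal (Real.exp 1) ^ S.card * ∏ _i ∈ S, ENNReal.ofReal (2 / σ) := by
        gcongr with i hi
        have hunion : S.erase i ∪ Sᶜ = {i}ᶜ := by
          ext j
          by_cases hj : j ∈ S
          · simp [hj]
          · simpa [hj] using (ne_of_mem_of_not_mem hi hj).symm
        rw [← integrateOut_union hF.measurable
          (disjoint_compl_right.mono_left (Finset.erase_subset i S)), hunion]
        exact hF.integrateOut_compl_singleton_zero_le h1 hσ (h2 i hi)
    _ = ENNReal.ofReal (2 * Real.exp 1 / σ) ^ S.card := by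
        rw [Finset.prod_const, ← mul_pow, ← ENNReal.ofReal_mul (Real.exp_pos 1).le]
        congr 2; ring

omit [DecidableEq ι] in
theorem setLIntegral_pi_Iic_le (hF : IsOrthantLogConcave F)
    (h1 : ∫⁻ x, F x ∂orthantVolume ι = 1) {S : Finset ι} (hS : S.Nonempty)
    {σ p : ℝ} (hσ : 0 < σ) (hp : 0 < p)
    (h2 : ∀ i ∈ S,
      ENNReal.ofReal (σ ^ 2) ≤ ∫⁻ x, ENNReal.ofReal (x i ^ 2) * F x ∂orthantVolume ι) :
    ∫⁻ x in (S : Set ι).pi fun _ => Set.Iic p, F x ∂orthantVolume ι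
      ≤ ENNReal.ofReal (2 * Real.exp 1 * p / σ) ^ S.card := by
  classical
  have hdep : DependsOn (· ∈ (S : Set ι).pi fun _ => Set.Iic p) (S : Set ι) := fun x y h => by
    simp +contextual only [Set.mem_pi, h]
  have halfLine_Iic : halfLine (Set.Iic p) = ENNReal.ofReal p := by
    rw [halfLine, Measure.restrict_apply measurableSet_Iic, Set.inter_comm, Set.Ici_inter_Iic,
      Real.volume_Icc, sub_zero]
  calc ∫⁻ x in (S : Set ι).pi fun _ => Set.Iic p, F x ∂orthantVolume ι
      = integrateOut S (((S : Set ι).pi fun _ => Set.Iic p).indicator (integrateOut Sᶜ F)) 0 :=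
        setLIntegral_orthantVolume_eq_integrateOut hF.measurable
          (.pi S.countable_toSet fun _ _ => measurableSet_Iic) hdep
    _ ≤ integrateOut S
          (((S : Set ι).pi fun _ => Set.Iic p).indicator fun _ => integrateOut Sᶜ F 0) 0 :=
        lintegral_mono fun _ => Set.indicator_le_indicator
          ((isOrthantLogConcave_integrateOut hF Sᶜ).le_zero _)
    _ = ENNReal.ofReal p ^ S.card * integrateOut Sᶜ F 0 := by
        rw [integrateOut_indicator_pi_const S measurableSet_Iic, halfLine_Iic]
    _ ≤ ENNReal.ofReal p ^ S.card * ENNReal.ofReal (2 * Real.exp 1 / σ) ^ S.card := by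
        gcongr
        exact hF.integrateOut_compl_zero_le h1 hS hσ h2
    _ = _ := by
        rw [← mul_pow, ← ENNReal.ofReal_mul hp.le]
        congr 2; ring

theorem integrateOut_compl_indicator_lt_le (hF : IsOrthantLogConcave F) {M p : ℝ} (hM : 0 < M)
    (hp : 0 < p) {U : Finset ι} {e : ι} (he : e ∉ U) {x : ι → ℝ}
    (h2 : integrateOut Uᶜ (fun y => ENNReal.ofReal (y e ^ 2) * F y) x
      ≤ ENNReal.ofReal (M ^ 2) * integrateOut Uᶜ F x) :
    integrateOut Uᶜ ({y | p < y e}.indicator F) x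
      ≤ ENNReal.ofReal (Real.exp (-(3 / 8 * (p / M)))) * integrateOut Uᶜ F x := by
  have hslice := (isOrthantLogConcave_integrateOut hF (insert e U)ᶜ).slice x e
  rw [integrateOut_compl_mul_eq_lintegral (k := fun r => ENNReal.ofReal (r ^ 2)) he hF.measurable
    (by fun_prop), integrateOut_compl_eq_lintegral he hF.measurable] at h2
  have hmeas : MeasurableSet {y : ι → ℝ | p < y e} := measurable_pi_apply e measurableSet_Ioi
  rw [integrateOut_compl_eq_lintegral he (hF.measurable.indicator hmeas),
    integrateOut_compl_eq_lintegral he hF.measurable,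
    integrateOut_indicator_of_dependsOn hF.measurable fun y z h => by
      simp [h e (by simp)]]
  refine le_of_eq_of_le ?_ (hslice.setLIntegral_Ioi_le_exp hM hp h2)
  rw [← lintegral_indicator measurableSet_Ioi]
  exact lintegral_congr fun r => by simp [Set.indicator]

theorem setLIntegral_inter_lt_le (hF : IsOrthantLogConcave F) {M p : ℝ} (hM : 0 < M) (hp : 0 < p)
    {U : Finset ι} {e : ι} (he : e ∉ U)
    (h2 : ∀ x, integrateOut Uᶜ (fun y => ENNReal.ofReal (y e ^ 2) * F y) x
      ≤ ENNReal.ofReal (M ^ 2) * integrateOut Uᶜ F x)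
    {E : Set (ι → ℝ)} (hEm : MeasurableSet E) (hE : DependsOn (· ∈ E) U) :
    ∫⁻ x in E ∩ {x | p < x e}, F x ∂orthantVolume ι
      ≤ ENNReal.ofReal (Real.exp (-(3 / 8 * (p / M)))) * ∫⁻ x in E, F x ∂orthantVolume ι := by
  have hmeas : MeasurableSet {y : ι → ℝ | p < y e} := measurable_pi_apply e measurableSet_Ioi
  have hcond (x : ι → ℝ) : E.indicator (integrateOut Uᶜ ({x | p < x e}.indicator F)) x
      ≤ ENNReal.ofReal (Real.exp (-(3 / 8 * (p / M)))) * E.indicator (integrateOut Uᶜ F) x := by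
    by_cases hx : x ∈ E
    · simp only [Set.indicator_of_mem hx]
      exact hF.integrateOut_compl_indicator_lt_le hM hp he (h2 x)
    · simp [Set.indicator_of_notMem hx]
  rw [Set.inter_comm, ← setLIntegral_indicator hmeas,
    setLIntegral_orthantVolume_eq_integrateOut (hF.measurable.indicator hmeas) hEm hE,
    setLIntegral_orthantVolume_eq_integrateOut hF.measurable hEm hE]
  exact (lintegral_mono fun y => hcond _).trans_eq
    (lintegral_const_mul' _ _ ENNReal.ofReal_ne_top)

theorem setLIntegral_inter_pi_Ioi_le (hF : IsOrthantLogConcave F) {M p : ℝ} (hM : 0 < M)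
    (hp : 0 < p)
    (h2 : ∀ U : Finset ι, U.Nonempty → ∀ e ∉ U, ∀ x,
      integrateOut Uᶜ (fun y => ENNReal.ofReal (y e ^ 2) * F y) x
        ≤ ENNReal.ofReal (M ^ 2) * integrateOut Uᶜ F x)
    {S : Finset ι} (hS : S.Nonempty) {E : Set (ι → ℝ)} (hEm : MeasurableSet E)
    (hE : DependsOn (· ∈ E) S) {T : Finset ι} (hST : Disjoint S T) :
    ∫⁻ x in E ∩ (T : Set ι).pi fun _ => Set.Ioi p, F x ∂orthantVolume ι
      ≤ ENNReal.ofReal (Real.exp (-(3 / 8 * (p / M)))) ^ T.card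
        * ∫⁻ x in E, F x ∂orthantVolume ι := by
  induction T using Finset.induction_on with
  | empty => simp
  | insert e T he ih =>
    rw [Finset.disjoint_insert_right] at hST
    have hsplit : E ∩ ((insert e T : Finset ι) : Set ι).pi (fun _ => Set.Ioi p)
        = E ∩ (T : Set ι).pi (fun _ => Set.Ioi p) ∩ {x | p < x e} := by
      ext x
      simp only [Finset.coe_insert, Set.insert_pi, Set.mem_inter_iff, Set.mem_preimage,
        Function.eval, Set.mem_Ioi, Set.mem_ofPred_eq]
      tauto
    have hdep : DependsOn (· ∈ E ∩ (T : Set ι).pi fun _ => Set.Ioi p)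
        ((S ∪ T : Finset ι) : Set ι) := fun x y h => by
      refine congrArg₂ And (hE fun i hi => h i (by simp_all)) (propext (forall₂_congr ?_))
      exact fun i hi => by rw [h i (by simp_all)]
    rw [hsplit, Finset.card_insert_of_notMem he, pow_succ', mul_assoc]
    refine (hF.setLIntegral_inter_lt_le (U := S ∪ T) hM hp (by simp [hST.1, he])
      (h2 _ (hS.mono Finset.subset_union_left) e (by simp [hST.1, he]))
      (hEm.inter (.pi T.countable_toSet fun _ _ => measurableSet_Ioi)) hdep).trans ?_
    gcongr
    exact ih hST.2

end IsOrthantLogConcave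

end Marginals

section Density

/-- The density `f` on `[0,∞)^ι`, extended to all of `ι → ℝ` through positive parts. This makes
it antitone on the whole space, unlike the extension by zero. -/
noncomputable def extendDensity {ι : Type*} (f : (ι → ℝ) → ℝ) (x : ι → ℝ) : ℝ≥0∞ :=
  ENNReal.ofReal (f (x ⊔ 0))

variable {ι : Type*} {f : (ι → ℝ) → ℝ}

theorem isOrthantLogConcave_extendDensity (hf : IsLogConcaveDownMonotone f)
    (hm : Measurable f) : IsOrthantLogConcave (extendDensity f) where
  measurable := ENNReal.measurable_ofReal.comp (hm.comp (measurable_pi_lambda _ fun i =>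
    (measurable_pi_apply i).max measurable_const))
  antitone x y h := ENNReal.ofReal_le_ofReal
    (hf.downMonotone _ _ le_sup_right (sup_le_sup_right h 0))
  sup_zero x := by simp [extendDensity]
  logConcave x y s t hs ht hst := by
    simp only [extendDensity]
    rw [ENNReal.ofReal_rpow_of_nonneg (hf.nonneg _) hs.le,
      ENNReal.ofReal_rpow_of_nonneg (hf.nonneg _) ht.le,
      ← ENNReal.ofReal_mul (Real.rpow_nonneg (hf.nonneg _) _)]
    refine ENNReal.ofReal_le_ofReal ((hf.logConcave _ _ le_sup_right le_sup_right s t hs ht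
      hst).trans (hf.downMonotone _ _ le_sup_right (sup_le ?_ ?_)))
    · gcongr <;> exact le_sup_left
    · exact add_nonneg (smul_nonneg hs.le le_sup_right) (smul_nonneg ht.le le_sup_right)

variable [Fintype ι]

theorem orthantVolume_eq_restrict :
    orthantVolume ι = volume.restrict (Set.Ici (0 : ι → ℝ)) := by
  rw [orthantVolume, halfLine, ← Measure.restrict_pi_pi, volume_pi, Set.pi_univ_Ici]
  rfl

theorem lintegral_orthantVolume_eq_volume {g h : (ι → ℝ) → ℝ≥0∞} (hgh : ∀ x, 0 ≤ x → g x = h x)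
    (hh : ∀ x, ¬ 0 ≤ x → h x = 0) : ∫⁻ x, g x ∂orthantVolume ι = ∫⁻ x, h x := by
  rw [orthantVolume_eq_restrict, setLIntegral_congr_fun measurableSet_Ici hgh]
  exact setLIntegral_eq_of_support_subset fun x hx => not_not.1 fun hx0 => hx (hh x hx0)

theorem lintegral_mul_extendDensity (hf : IsLogConcaveDownMonotone f) (g : (ι → ℝ) → ℝ≥0∞) :
    ∫⁻ x, g x * extendDensity f x ∂orthantVolume ι = ∫⁻ x, g x * ENNReal.ofReal (f x) :=
  lintegral_orthantVolume_eq_volume (fun x hx => by rw [extendDensity, sup_eq_left.2 hx])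
    fun x hx => by simp [hf.support x hx]

variable [DecidableEq ι]

theorem integrateOut_compl_eq_glue (G : (ι → ℝ) → ℝ≥0∞) (U : Finset ι) (x : ι → ℝ) :
    integrateOut Uᶜ G x
      = ∫⁻ z, G (glue U (fun i => x i) z) ∂orthantVolume {i // i ∉ U} := by
  let e : {i // i ∈ Uᶜ} ≃ {i // i ∉ U} := Equiv.subtypeEquivRight fun i => Finset.mem_compl
  rw [(measurePreserving_piCongrLeft (fun _ : {i // i ∉ U} => halfLine) e).lintegral_map_equiv]
  refine lintegral_congr fun y => congrArg G ?_
  ext i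
  by_cases hi : i ∈ U
  · simp [glue, Function.updateFinset, hi]
  · have hi' : i ∈ Uᶜ := Finset.mem_compl.2 hi
    simp only [glue, Function.updateFinset, hi, hi', dif_pos, dif_neg, not_false_eq_true]
    exact (Equiv.piCongrLeft_apply_apply (fun _ => ℝ) e y ⟨i, hi'⟩).symm

theorem integrateOut_compl_mul_extendDensity (hf : IsLogConcaveDownMonotone f)
    (U : Finset ι) {k : ({i // i ∉ U} → ℝ) → ℝ} (hk : ∀ z, 0 ≤ k z) (x : ι → ℝ) :
    integrateOut Uᶜ (fun y => ENNReal.ofReal (k fun i => y i) * extendDensity f y) x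
      = ∫⁻ z, ENNReal.ofReal (k z * f (glue U (fun i => x i ⊔ 0) z)) := by
  rw [integrateOut_compl_eq_glue]
  have glue_restrict (y : {i // i ∈ U} → ℝ) (z) : (fun i : {i // i ∉ U} => glue U y z i) = z := by
    ext i
    simp [glue, i.2]
  refine lintegral_orthantVolume_eq_volume (fun z hz => ?_) fun z hz => ?_
  · rw [glue_restrict, ENNReal.ofReal_mul (hk z), extendDensity]
    congr 3
    ext i
    by_cases hi : i ∈ U
    · simp [glue, hi]
    · simpa [glue, hi] using hz ⟨i, hi⟩
  · rw [hf.support, mul_zero, ENNReal.ofReal_zero]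
    exact fun h => hz fun i => by simpa [glue, i.2] using h i

theorem condSecondMoment_le_maxCondSecondMoment {U : Finset ι} (hU : U.Nonempty)
    {y : {i // i ∈ U} → ℝ} (hy : 0 ≤ y) (hpos : marginalDensity f U y ≠ 0) (e : {i // i ∉ U}) :
    condSecondMoment f U y e ≤ maxCondSecondMoment f :=
  le_iSup_of_le U <| le_iSup_of_le hU <| le_iSup_of_le y <| le_iSup_of_le hy <|
    le_iSup_of_le hpos <| le_iSup (condSecondMoment f U y) e

theorem integrateOut_compl_sq_mul_extendDensity_le (hf : IsLogConcaveDownMonotone f)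
    (hm : Measurable f) {c : ℝ≥0∞} (hc : c ≠ 0) (hmax : maxCondSecondMoment f ≤ c)
    {U : Finset ι} (hU : U.Nonempty) {e : ι} (he : e ∉ U) (x : ι → ℝ) :
    integrateOut Uᶜ (fun y => ENNReal.ofReal (y e ^ 2) * extendDensity f y) x
      ≤ c * integrateOut Uᶜ (extendDensity f) x := by
  have hmarg : integrateOut Uᶜ (extendDensity f) x = marginalDensity f U fun i => x i ⊔ 0 := by
    have h := integrateOut_compl_mul_extendDensity hf U (fun _ => zero_le_one) x
    simp only [ENNReal.ofReal_one, one_mul] at h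
    exact h
  rcases eq_or_ne (integrateOut Uᶜ (extendDensity f) x) ∞ with htop | htop
  · rw [htop, ENNReal.mul_top hc]
    exact le_top
  rcases eq_or_ne (integrateOut Uᶜ (extendDensity f) x) 0 with h0 | h0
  · have hslice := (lintegral_eq_zero_iff ((isOrthantLogConcave_extendDensity hf hm).measurable.comp
      measurable_updateFinset)).1 h0
    refine ((lintegral_congr_ae (hslice.mono fun y hy => ?_)).trans lintegral_zero).trans_le zero_le
    exact mul_eq_zero_of_right _ hy
  · have hcond := condSecondMoment_le_maxCondSecondMoment hU (y := fun i => x i ⊔ 0)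
      (fun i => le_sup_right) (hmarg ▸ h0) ⟨e, he⟩
    rw [condSecondMoment, ← hmarg, ENNReal.div_le_iff h0 htop] at hcond
    rw [integrateOut_compl_mul_extendDensity hf U (k := fun z => z ⟨e, he⟩ ^ 2)
      (fun z => sq_nonneg _) x]
    exact hcond.trans (mul_le_mul_left hmax _)

end Density

section TailBounds

/-- Tail bounds for the coordinates of a random vector: any set `S` of coordinates is at most `p`
and any disjoint set `T` exceeds `p` with the probability that suitable independent exponential
variables of scales `σ` and `M` would allow, up to constants. -/
structure HasTailBounds {ι Ω : Type*} [MeasurableSpace Ω] (P : Measure Ω) (X : Ω → ι → ℝ)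
    (σ M : ℝ) : Prop where
  sigma_pos : 0 < σ
  sigma_le : σ ≤ M
  joint : ∀ p > 0, ∀ S T : Finset ι, S.Nonempty → Disjoint S T →
    P.real {ω | (∀ i ∈ S, X ω i ≤ p) ∧ ∀ i ∈ T, p < X ω i}
      ≤ (2 * Real.exp 1 * p / σ) ^ S.card * Real.exp (-(3 / 8 * (p / M))) ^ T.card
  tail : ∀ p > 0, ∀ T : Finset ι, T.Nonempty →
    P.real {ω | ∀ i ∈ T, p < X ω i} ≤ Real.exp (-(3 / 8 * (p / M))) ^ (T.card - 1)

variable {ι Ω : Type*} [Fintype ι] [MeasurableSpace Ω] {P : Measure Ω} {X : Ω → ι → ℝ}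

section

variable {ρ : (ι → ℝ) → ℝ≥0∞}

theorem ae_ne_of_map_eq_withDensity (hX : Measurable X) (hP : P.map X = volume.withDensity ρ)
    (e : ι) (a : ℝ) : ∀ᵐ ω ∂P, X ω e ≠ a := by
  refine ae_of_ae_map hX.aemeasurable (p := fun x => x e ≠ a) ?_
  rw [hP, volume_pi]
  exact (withDensity_absolutelyContinuous _ _).ae_le
    ((Measure.quasiMeasurePreserving_eval (fun _ : ι => (volume : Measure ℝ)) e).ae
      (Measure.ae_ne volume a))

theorem integral_sq_pos_of_map_eq_withDensity [IsProbabilityMeasure P] (hX : Measurable X)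
    (hP : P.map X = volume.withDensity ρ) {e : ι} (hint : Integrable (fun ω => X ω e ^ 2) P) :
    0 < ∫ ω, X ω e ^ 2 ∂P := by
  have hsupport : Function.support (fun ω => X ω e ^ 2) =ᵐ[P] Set.univ :=
    Filter.eventuallyEq_univ.2 ((ae_ne_of_map_eq_withDensity hX hP e 0).mono fun ω hω =>
      pow_ne_zero 2 hω)
  rw [integral_pos_iff_support_of_nonneg (fun ω => sq_nonneg _) hint, measure_congr hsupport,
    measure_univ]
  exact one_pos

end

variable {f : (ι → ℝ) → ℝ} (hf : IsLogConcaveDownMonotone f) (hm : Measurable f)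
  (hX : Measurable X) (hP : P.map X = volume.withDensity fun x => ENNReal.ofReal (f x))

include hf hm hX hP

theorem lintegral_comp_eq_orthantVolume {g : (ι → ℝ) → ℝ≥0∞} (hg : Measurable g) :
    ∫⁻ ω, g (X ω) ∂P = ∫⁻ x, g x * extendDensity f x ∂orthantVolume ι := by
  rw [lintegral_mul_extendDensity hf, ← lintegral_map hg hX, hP,
    lintegral_withDensity_eq_lintegral_mul _ hm.ennreal_ofReal hg]
  simp only [Pi.mul_apply, mul_comm]

theorem measure_preimage_eq_orthantVolume {E : Set (ι → ℝ)} (hE : MeasurableSet E) :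
    P (X ⁻¹' E) = ∫⁻ x in E, extendDensity f x ∂orthantVolume ι := by
  rw [← lintegral_indicator_one (hX hE), ← lintegral_indicator hE]
  refine (lintegral_comp_eq_orthantVolume hf hm hX hP (measurable_one.indicator hE)).trans ?_
  simp only [← Set.indicator_mul_left, Pi.one_apply, one_mul]

theorem lintegral_extendDensity_eq_one [IsProbabilityMeasure P] :
    ∫⁻ x, extendDensity f x ∂orthantVolume ι = 1 := by
  simpa using (measure_preimage_eq_orthantVolume hf hm hX hP MeasurableSet.univ).symm

theorem measure_pi_Iic_le [IsProbabilityMeasure P] {σ p : ℝ} (hσ : 0 < σ) (hp : 0 < p)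
    {S : Finset ι} (hS : S.Nonempty)
    (h2 : ∀ e, ENNReal.ofReal (σ ^ 2) ≤ ∫⁻ ω, ENNReal.ofReal (X ω e ^ 2) ∂P) :
    P (X ⁻¹' (S : Set ι).pi fun _ => Set.Iic p)
      ≤ ENNReal.ofReal (2 * Real.exp 1 * p / σ) ^ S.card := by
  rw [measure_preimage_eq_orthantVolume hf hm hX hP
    (.pi S.countable_toSet fun _ _ => measurableSet_Iic)]
  refine (isOrthantLogConcave_extendDensity hf hm).setLIntegral_pi_Iic_le
    (lintegral_extendDensity_eq_one hf hm hX hP) hS hσ hp fun e _ => (h2 e).trans_eq ?_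
  exact lintegral_comp_eq_orthantVolume hf hm hX hP (g := fun x => ENNReal.ofReal (x e ^ 2))
    (by fun_prop)

variable [DecidableEq ι]

theorem measure_inter_pi_Ioi_le (hM : 0 < maxCondRMS f) {p : ℝ} (hp : 0 < p) {S T : Finset ι}
    (hS : S.Nonempty) {E : Set (ι → ℝ)} (hEm : MeasurableSet E) (hE : DependsOn (· ∈ E) S)
    (hST : Disjoint S T) :
    P (X ⁻¹' (E ∩ (T : Set ι).pi fun _ => Set.Ioi p))
      ≤ ENNReal.ofReal (Real.exp (-(3 / 8 * (p / maxCondRMS f)))) ^ T.card * P (X ⁻¹' E) := by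
  have hfin : maxCondSecondMoment f ≠ ∞ := fun h => hM.ne' (by simp [maxCondRMS, h])
  have hM2 : maxCondSecondMoment f = ENNReal.ofReal (maxCondRMS f ^ 2) := by
    rw [maxCondRMS, Real.sq_sqrt ENNReal.toReal_nonneg, ENNReal.ofReal_toReal hfin]
  rw [measure_preimage_eq_orthantVolume hf hm hX hP hEm,
    measure_preimage_eq_orthantVolume hf hm hX hP
      (hEm.inter (.pi T.countable_toSet fun _ _ => measurableSet_Ioi))]
  exact (isOrthantLogConcave_extendDensity hf hm).setLIntegral_inter_pi_Ioi_le hM hp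
    (fun U hU e he x => integrateOut_compl_sq_mul_extendDensity_le hf hm (by simpa using hM.ne')
      hM2.le hU he x) hS hEm hE hST

variable [IsProbabilityMeasure P]

theorem lintegral_sq_le_maxCondSecondMoment [Nontrivial ι] (e : ι) :
    ∫⁻ ω, ENNReal.ofReal (X ω e ^ 2) ∂P ≤ maxCondSecondMoment f := by
  refine le_of_forall_gt_imp_ge_of_dense fun c hc => ?_
  obtain ⟨e', he'⟩ := exists_ne e
  have hF := (isOrthantLogConcave_extendDensity hf hm).measurable
  have hg : Measurable fun x : ι → ℝ => ENNReal.ofReal (x e ^ 2) := by fun_prop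
  calc ∫⁻ ω, ENNReal.ofReal (X ω e ^ 2) ∂P
      = integrateOut {e'} (integrateOut {e'}ᶜ
          fun x => ENNReal.ofReal (x e ^ 2) * extendDensity f x) 0 := by
        rw [lintegral_comp_eq_orthantVolume hf hm hX hP hg,
          ← lintegral_orthantVolume_eq_integrateOut (by fun_prop) {e'} 0]
    _ ≤ integrateOut {e'} (fun x => c * integrateOut {e'}ᶜ (extendDensity f) x) 0 :=
        lintegral_mono fun _ => integrateOut_compl_sq_mul_extendDensity_le hf hm
          (ne_bot_of_gt hc) hc.le (Finset.singleton_nonempty e')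
          (Finset.notMem_singleton.2 he'.symm) _
    _ = c := by
        refine (lintegral_const_mul _ ((hF.lmarginal _).comp measurable_updateFinset)).trans ?_
        refine (congrArg (c * ·) ?_).trans (mul_one c)
        rw [← lintegral_extendDensity_eq_one hf hm hX hP]
        exact (lintegral_orthantVolume_eq_integrateOut hF {e'} 0).symm

theorem hasTailBounds_maxCondRMS {σ : ℝ} (hσ : 0 < σ) (hσM : σ ≤ maxCondRMS f)
    (h2 : ∀ e, ENNReal.ofReal (σ ^ 2) ≤ ∫⁻ ω, ENNReal.ofReal (X ω e ^ 2) ∂P) :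
    HasTailBounds P X σ (maxCondRMS f) := by
  have hM := hσ.trans_le hσM
  have dependsOn_pi (S : Finset ι) (B : Set ℝ) :
      DependsOn (· ∈ (S : Set ι).pi fun _ => B) (S : Set ι) := fun x y h =>
    propext (forall₂_congr fun i hi => by rw [h i hi])
  refine ⟨hσ, hσM, fun p hp S T hS hST => ?_, fun p hp T ⟨e, he⟩ => ?_⟩
  · refine ENNReal.toReal_le_of_le_ofReal (by positivity) ?_
    rw [mul_comm, ENNReal.ofReal_mul (by positivity), ENNReal.ofReal_pow (by positivity),
      ENNReal.ofReal_pow (by positivity)]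
    exact (measure_inter_pi_Ioi_le hf hm hX hP hM hp hS
      (.pi S.countable_toSet fun _ _ => measurableSet_Iic) (dependsOn_pi S _) hST).trans
      (mul_le_mul_right (measure_pi_Iic_le hf hm hX hP hσ hp hS h2) _)
  · refine ENNReal.toReal_le_of_le_ofReal (by positivity) ?_
    rw [ENNReal.ofReal_pow (by positivity), ← Finset.card_erase_of_mem he]
    refine (measure_mono fun ω (hω : ∀ i ∈ T, p < X ω i) => ?_).trans
      ((measure_inter_pi_Ioi_le hf hm hX hP hM hp (Finset.singleton_nonempty e)
        (.pi ({e} : Finset ι).countable_toSet fun _ _ => measurableSet_Ioi)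
        (dependsOn_pi {e} (Set.Ioi p))
        (Finset.disjoint_singleton_left.2 (Finset.notMem_erase e T))).trans
        (mul_le_of_le_one_right' prob_le_one))
    exact ⟨fun i hi => hω i (Finset.mem_singleton.1 hi ▸ he),
      fun i hi => hω i (Finset.mem_of_mem_erase hi)⟩

variable [Nontrivial ι]

theorem integrable_sq_of_maxCondSecondMoment_ne_top (hfin : maxCondSecondMoment f ≠ ∞) (e : ι) :
    Integrable (fun ω => X ω e ^ 2) P := by
  have hmeas : Measurable fun ω => X ω e ^ 2 := by fun_prop
  exact (lintegral_ofReal_ne_top_iff_integrable hmeas.aestronglyMeasurable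
    (ae_of_all P fun ω => sq_nonneg _)).1
    (ne_top_of_le_ne_top hfin (lintegral_sq_le_maxCondSecondMoment hf hm hX hP e))

theorem hasTailBounds (hfin : maxCondSecondMoment f ≠ ∞) :
    HasTailBounds P X √(⨅ e : ι, ∫ ω, X ω e ^ 2 ∂P) (maxCondRMS f) := by
  have hint := integrable_sq_of_maxCondSecondMoment_ne_top hf hm hX hP hfin
  obtain ⟨e₀, he₀⟩ := exists_eq_ciInf_of_finite (f := fun e : ι => ∫ ω, X ω e ^ 2 ∂P)
  have hpos : 0 < ⨅ e : ι, ∫ ω, X ω e ^ 2 ∂P :=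
    he₀ ▸ integral_sq_pos_of_map_eq_withDensity hX hP (hint e₀)
  have hlintegral (e : ι) : ENNReal.ofReal (∫ ω, X ω e ^ 2 ∂P)
      = ∫⁻ ω, ENNReal.ofReal (X ω e ^ 2) ∂P :=
    ofReal_integral_eq_lintegral_ofReal (hint e) (ae_of_all P fun ω => sq_nonneg _)
  refine hasTailBounds_maxCondRMS hf hm hX hP (Real.sqrt_pos.2 hpos) (Real.sqrt_le_sqrt ?_)
    fun e => ?_
  · rw [← he₀, ← ENNReal.ofReal_le_iff_le_toReal hfin, hlintegral]
    exact lintegral_sq_le_maxCondSecondMoment hf hm hX hP e₀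
  · rw [Real.sq_sqrt hpos.le, ← hlintegral]
    exact ENNReal.ofReal_le_ofReal (ciInf_le (Set.finite_range _).bddBelow e)

end TailBounds

section Trees

/-- `π` is the parent map of a tree contained in `G` with vertex set `K` and root `r`. It fixes
the root and the vertices off `K`, and injectivity of `v ↦ s(v, π v)` on `K` says that the tree
has as many edges as `K` has vertices other than `r`. -/
structure IsParentMap {V : Type*} (G : SimpleGraph V) (K : Finset V) (r : V) (π : V → V) :
    Prop where
  root_mem : r ∈ K
  map_root : π r = r
  map_mem : ∀ v ∈ K, π v ∈ K
  map_of_notMem : ∀ v ∉ K, π v = v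
  adj : ∀ v ∈ K, v ≠ r → G.Adj v (π v)
  injOn : Set.InjOn (fun v => s(v, π v)) K

variable {V : Type*} {G : SimpleGraph V} {K : Finset V} {r : V} {π : V → V}

namespace IsParentMap

theorem map_eq_self_iff (h : IsParentMap G K r π) {v : V} (hv : v ∈ K) : π v = v ↔ v = r :=
  ⟨fun hπ => by_contra fun hvr => (h.adj v hv hvr).ne' hπ, fun hvr => hvr ▸ h.map_root⟩

theorem singleton (G : SimpleGraph V) (r : V) : IsParentMap G {r} r id := by
  constructor <;> simp

theorem insert [DecidableEq V] (h : IsParentMap G K r π) {u v : V} (hu : u ∈ K) (hv : v ∉ K)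
    (huv : G.Adj v u) : IsParentMap G (insert v K) r (Function.update π v u) := by
  have hupdate (w : V) (hw : w ∈ K) : Function.update π v u w = π w :=
    Function.update_of_ne (fun hwv : w = v => hv (hwv ▸ hw)) _ _
  refine ⟨Finset.mem_insert_of_mem h.root_mem, (hupdate r h.root_mem).trans h.map_root,
    fun w hw => ?_, fun w hw => ?_, fun w hw hwr => ?_, ?_⟩
  · rcases Finset.mem_insert.1 hw with rfl | hw
    · simpa using Or.inr hu
    · rw [hupdate w hw]
      exact Finset.mem_insert_of_mem (h.map_mem w hw)
  · rw [Finset.mem_insert, not_or] at hw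
    rw [Function.update_of_ne hw.1, h.map_of_notMem w hw.2]
  · rcases Finset.mem_insert.1 hw with rfl | hw
    · simpa using huv
    · rw [hupdate w hw]
      exact h.adj w hw hwr
  · rw [Finset.coe_insert, Set.injOn_insert hv]
    refine ⟨h.injOn.congr fun w hw => by rw [hupdate w hw], ?_⟩
    rintro ⟨w, hw, hwv : s(w, Function.update π v u w) = _⟩
    have hmem : v ∈ s(w, π w) := by
      rw [← hupdate w hw, hwv]
      exact Sym2.mem_mk_left _ _
    rcases Sym2.mem_iff.1 hmem with rfl | rfl
    · exact hv hw
    · exact hv (h.map_mem w hw)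

end IsParentMap

theorem exists_isParentMap (C : G.ConnectedComponent) {k : ℕ} (hk : 1 ≤ k)
    (hkC : k ≤ componentOrder C) :
    ∃ (K : Finset V) (r : V) (π : V → V),
      (K : Set V) ⊆ C.supp ∧ K.card = k ∧ IsParentMap G K r π := by
  classical
  induction k, hk using Nat.le_induction with
  | base =>
    obtain ⟨r, hr⟩ := C.nonempty_supp
    exact ⟨{r}, r, id, by simpa using hr, Finset.card_singleton r, .singleton G r⟩
  | succ k _ ih =>
    obtain ⟨K, r, π, hKC, hcard, hπ⟩ := ih (by omega)
    obtain ⟨z, hzC, hzK⟩ : ∃ z ∈ C.supp, z ∉ (K : Set V) := by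
      by_contra! hsub
      have hle := Set.ncard_le_ncard (s := C.supp) (t := K) hsub K.finite_toSet
      rw [Set.ncard_coe_finset, hcard] at hle
      exact absurd (hkC.trans hle) (by omega)
    obtain ⟨W⟩ : G.Reachable r z :=
      SimpleGraph.ConnectedComponent.exact ((hKC hπ.root_mem).trans hzC.symm)
    obtain ⟨d, -, hu, hv⟩ := W.exists_boundary_dart (K : Set V) hπ.root_mem hzK
    refine ⟨insert d.snd K, r, _, ?_, ?_, hπ.insert (Finset.mem_coe.1 hu) hv d.adj.symm⟩
    · rw [Finset.coe_insert, Set.insert_subset_iff]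
      exact ⟨C.mem_supp_of_adj_mem_supp (hKC hu) d.adj, hKC⟩
    · rw [Finset.card_insert_of_notMem (mt Finset.mem_coe.2 hv), hcard]

end Trees

section Components

variable {V : Type*} [Fintype V] (G : SimpleGraph V)

/- Take a maximal union of components with at most two thirds of the vertices. If it has less
than one third, adding any further component overshoots, so that component will do by itself. -/
theorem exists_finset_card_of_componentOrder_le
    (hG : ∀ C : G.ConnectedComponent, 2 * componentOrder C ≤ Fintype.card V) :
    ∃ K : Finset V, Fintype.card V ≤ 3 * K.card ∧ 3 * K.card ≤ 2 * Fintype.card V ∧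
      ∀ u v, G.Adj u v → (u ∈ K ↔ v ∈ K) := by
  classical
  obtain ⟨K, hK, hmax⟩ := Finset.exists_max_image
    (Finset.univ.filter fun K : Finset V => 3 * K.card ≤ 2 * Fintype.card V ∧
      ∀ u v, G.Adj u v → (u ∈ K ↔ v ∈ K)) Finset.card ⟨∅, by simp⟩
  simp only [Finset.mem_filter_univ] at hK hmax
  rcases le_or_gt (Fintype.card V) (3 * K.card) with hlarge | hsmall
  · exact ⟨K, hlarge, hK⟩
  obtain ⟨v, hv⟩ : ∃ v, v ∉ K := by
    by_contra! hall
    rw [Finset.eq_univ_iff_forall.2 hall, Finset.card_univ] at hsmall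
    omega
  let D : Finset V := (G.connectedComponentMk v).supp.toFinset
  have hD : ∀ u w, G.Adj u w → (u ∈ D ↔ w ∈ D) := fun u w huw => by
    simpa only [D, Set.mem_toFinset] using
      SimpleGraph.ConnectedComponent.mem_supp_congr_adj _ huw
  have hDcard : 2 * D.card ≤ Fintype.card V := by
    simpa only [D, componentOrder, Set.ncard_eq_toFinset_card'] using hG (G.connectedComponentMk v)
  have hovershoot : 2 * Fintype.card V < 3 * (K ∪ D).card := by
    by_contra! hle
    have hvD : v ∈ D := Set.mem_toFinset.2 rfl
    refine (hmax (K ∪ D) ⟨hle, fun u w huw => ?_⟩).not_gt (Finset.card_lt_card ?_)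
    · rw [Finset.mem_union, Finset.mem_union, hK.2 u w huw, hD u w huw]
    · exact ⟨Finset.subset_union_left, fun hsub => hv (hsub (Finset.mem_union_right _ hvD))⟩
  have hunion := Finset.card_union_le K D
  exact ⟨D, by omega, by omega, hD⟩

theorem existsUnique_lt_componentOrder_or_forall_le :
    (∃! C : G.ConnectedComponent, Fintype.card V < 2 * componentOrder C) ∨
      ∀ C : G.ConnectedComponent, 2 * componentOrder C ≤ Fintype.card V := by
  refine or_iff_not_imp_right.2 fun hG => ?_
  obtain ⟨C, hC⟩ := not_forall.1 hG
  refine ⟨C, not_le.1 hC, fun D hD => by_contra fun hne => ?_⟩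
  have hunion := Set.ncard_union_eq
    (SimpleGraph.pairwise_disjoint_supp_connectedComponent G hne) (Set.toFinite _) (Set.toFinite _)
  have hcard := Set.ncard_le_card (D.supp ∪ C.supp)
  rw [hunion, Nat.card_eq_fintype_card] at hcard
  simp only [componentOrder] at hC hD
  omega

end Components

section EdgeSets

variable {n k : ℕ} {K : Finset (Fin n)} {π : Fin n → Fin n} {r : Fin n}
  {x : EdgeIdx n → ℝ} {p : ℝ}

/-- The index pair `(i, j)` as the unordered pair `{i, j}`. -/
def edgeSym2 (e : EdgeIdx n) : Sym2 (Fin n) :=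
  s(e.1.1, e.1.2)

theorem edgeSym2_injective : Function.Injective (edgeSym2 (n := n)) := by
  rintro ⟨⟨a, b⟩, hab⟩ ⟨⟨c, d⟩, hcd⟩ heq
  rcases Sym2.eq_iff.1 heq with ⟨rfl, rfl⟩ | ⟨rfl, rfl⟩
  · rfl
  · exact absurd hab (lt_asymm hcd)

theorem exists_edgeSym2_eq {z : Sym2 (Fin n)} (hz : ¬ z.IsDiag) :
    ∃ e : EdgeIdx n, edgeSym2 e = z := by
  induction z with | _ u v
  rcases lt_or_gt_of_ne (mt Sym2.mk_isDiag_iff.2 hz) with huv | hvu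
  · exact ⟨⟨(u, v), huv⟩, rfl⟩
  · exact ⟨⟨(v, u), hvu⟩, Sym2.eq_swap⟩

theorem not_isDiag_edgeSym2 (e : EdgeIdx n) : ¬ (edgeSym2 e).IsDiag :=
  fun h => e.2.ne (Sym2.mk_isDiag_iff.1 h)

theorem edgeSym2_mem_edgeSet_thresholdGraph {e : EdgeIdx n} :
    edgeSym2 e ∈ (thresholdGraph x p).edgeSet ↔ x e ≤ p := by
  refine SimpleGraph.mem_edgeSet _ |>.trans ⟨?_, fun h => Or.inl ⟨e.2, h⟩⟩
  rintro (⟨_, h⟩ | ⟨h, _⟩)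
  · exact h
  · exact absurd e.2 (lt_asymm h)

/-- The index pairs of the members of a set `E` of unordered pairs; loops in `E` are ignored. -/
def edgesOf (E : Finset (Sym2 (Fin n))) : Finset (EdgeIdx n) :=
  Finset.univ.filter fun e => edgeSym2 e ∈ E

theorem mem_edgesOf {E : Finset (Sym2 (Fin n))} {e : EdgeIdx n} :
    e ∈ edgesOf E ↔ edgeSym2 e ∈ E :=
  Finset.mem_filter_univ _

theorem card_edgesOf (E : Finset (Sym2 (Fin n))) :
    (edgesOf E).card = (E.filter fun z => ¬ z.IsDiag).card := by
  rw [← Finset.card_image_of_injective _ edgeSym2_injective]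
  congr 1
  ext z
  simp only [Finset.mem_image, mem_edgesOf, Finset.mem_filter]
  constructor
  · rintro ⟨e, he, rfl⟩
    exact ⟨he, not_isDiag_edgeSym2 e⟩
  · rintro ⟨hz, hdiag⟩
    obtain ⟨e, rfl⟩ := exists_edgeSym2_eq hdiag
    exact ⟨e, hz, rfl⟩

/-- The edges of the tree on `K` with parent map `π`. -/
def treeEdges (K : Finset (Fin n)) (π : Fin n → Fin n) : Finset (EdgeIdx n) :=
  edgesOf (K.image fun v => s(v, π v))

/-- The edges joining `K` to its complement. -/
def cutEdges (K : Finset (Fin n)) : Finset (EdgeIdx n) :=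
  edgesOf ((K ×ˢ Kᶜ).image fun q => s(q.1, q.2))

theorem mem_treeEdges {e : EdgeIdx n} :
    e ∈ treeEdges K π ↔ ∃ v ∈ K, s(v, π v) = edgeSym2 e :=
  mem_edgesOf.trans Finset.mem_image

theorem mem_cutEdges {e : EdgeIdx n} :
    e ∈ cutEdges K ↔ ∃ u ∈ K, ∃ v ∉ K, s(u, v) = edgeSym2 e := by
  simp only [cutEdges, mem_edgesOf, Finset.mem_image, Finset.mem_product, Finset.mem_compl,
    Prod.exists, and_assoc, exists_and_left]

theorem IsParentMap.card_treeEdges {G : SimpleGraph (Fin n)} (h : IsParentMap G K r π) :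
    (treeEdges K π).card = K.card - 1 := by
  rw [treeEdges, card_edgesOf, Finset.filter_image,
    Finset.card_image_of_injOn (h.injOn.mono (Finset.coe_subset.2 (Finset.filter_subset _ _))),
    ← Finset.card_erase_of_mem h.root_mem]
  congr 1
  ext v
  simp only [Finset.mem_filter, Finset.mem_erase, Sym2.mk_isDiag_iff, and_comm (a := v ≠ r)]
  exact and_congr_right fun hv => by rw [eq_comm, h.map_eq_self_iff hv]

theorem card_cutEdges (K : Finset (Fin n)) : (cutEdges K).card = K.card * (n - K.card) := by
  have hloopless : ∀ z ∈ (K ×ˢ Kᶜ).image fun q => s(q.1, q.2), ¬ z.IsDiag := by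
    rintro z hz hdiag
    obtain ⟨⟨u, v⟩, huv, rfl⟩ := Finset.mem_image.1 hz
    obtain rfl : u = v := Sym2.mk_isDiag_iff.1 hdiag
    simp at huv
  have hinj : Set.InjOn (fun q : Fin n × Fin n => s(q.1, q.2)) (K ×ˢ Kᶜ : Finset _) := by
    rintro ⟨a, b⟩ hab ⟨c, d⟩ hcd heq
    simp only [Finset.mem_coe, Finset.mem_product, Finset.mem_compl] at hab hcd
    rcases Sym2.eq_iff.1 heq with ⟨rfl, rfl⟩ | ⟨rfl, rfl⟩
    · rfl
    · exact absurd hab.1 hcd.2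
  rw [cutEdges, card_edgesOf, Finset.filter_true_of_mem hloopless, Finset.card_image_of_injOn hinj,
    Finset.card_product, Finset.card_compl, Fintype.card_fin]

theorem disjoint_treeEdges_cutEdges (hπ : ∀ v ∈ K, π v ∈ K) :
    Disjoint (treeEdges K π) (cutEdges K) := by
  refine Finset.disjoint_left.2 fun e htree hcut => ?_
  obtain ⟨w, hw, hwe⟩ := mem_treeEdges.1 htree
  obtain ⟨u, -, v, hv, huv⟩ := mem_cutEdges.1 hcut
  have hmem : v ∈ s(w, π w) := (hwe.trans huv.symm) ▸ Sym2.mem_mk_right u v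
  rcases Sym2.mem_iff.1 hmem with rfl | rfl
  · exact hv hw
  · exact hv (hπ w hw)

theorem lt_of_mem_cutEdges (hK : ∀ u v, (thresholdGraph x p).Adj u v → (u ∈ K ↔ v ∈ K))
    {e : EdgeIdx n} (he : e ∈ cutEdges K) : p < x e := by
  obtain ⟨u, hu, v, hv, huv⟩ := mem_cutEdges.1 he
  refine not_le.1 fun hle => hv ((hK u v ?_).1 hu)
  rwa [← SimpleGraph.mem_edgeSet, huv, edgeSym2_mem_edgeSet_thresholdGraph]

theorem IsParentMap.le_of_mem_treeEdges (h : IsParentMap (thresholdGraph x p) K r π)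
    {e : EdgeIdx n} (he : e ∈ treeEdges K π) : x e ≤ p := by
  obtain ⟨v, hv, hve⟩ := mem_treeEdges.1 he
  have hvr : v ≠ r := fun hvr =>
    not_isDiag_edgeSym2 e (hve ▸ Sym2.mk_isDiag_iff.2 ((h.map_eq_self_iff hv).2 hvr).symm)
  rw [← edgeSym2_mem_edgeSet_thresholdGraph, ← hve, SimpleGraph.mem_edgeSet]
  exact h.adj v hv hvr

/-- The pairs of a set `K` of `k` vertices and a self-map of `K` (extended by the identity) that
spans `k - 1` edges. Parent maps of trees on `k` vertices are of this form, and that the other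
such maps are counted as well is harmless in a union bound. -/
def parentMaps (n k : ℕ) : Finset (Σ _ : Finset (Fin n), Fin n → Fin n) :=
  ((Finset.univ.powersetCard k).sigma fun K =>
    Fintype.piFinset fun v => if v ∈ K then K else {v}).filter
      fun q => (treeEdges q.1 q.2).card = k - 1

theorem mem_parentMaps :
    ⟨K, π⟩ ∈ parentMaps n k ↔ (K.card = k ∧ (∀ v ∈ K, π v ∈ K) ∧ ∀ v ∉ K, π v = v) ∧
      (treeEdges K π).card = k - 1 := by
  simp only [parentMaps, Finset.mem_filter, Finset.mem_sigma, Finset.mem_powersetCard_univ,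
    Fintype.mem_piFinset, ← forall_and]
  refine and_congr_left' (and_congr_right' (forall_congr' fun v => ?_))
  by_cases hv : v ∈ K <;> simp [hv]

theorem card_parentMaps_le_choose_mul_pow (n k : ℕ) :
    (parentMaps n k).card ≤ n.choose k * k ^ k := by
  refine (Finset.card_filter_le _ _).trans_eq ?_
  have hfiber (K : Finset (Fin n)) (hK : K ∈ Finset.univ.powersetCard k) :
      (Fintype.piFinset fun v => if v ∈ K then K else {v}).card = k ^ k := by
    rw [Finset.mem_powersetCard_univ] at hK
    simp only [Fintype.card_piFinset, apply_ite Finset.card, hK, Finset.card_singleton,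
      Finset.prod_ite_mem, Finset.univ_inter, Finset.prod_const]
  rw [Finset.card_sigma, Finset.sum_congr rfl hfiber, Finset.sum_const, Finset.card_powersetCard,
    Finset.card_univ, Fintype.card_fin, smul_eq_mul]

theorem card_parentMaps_le (n k : ℕ) : ((parentMaps n k).card : ℝ) ≤ (Real.exp 1 * n) ^ k := by
  calc ((parentMaps n k).card : ℝ)
    _ ≤ n.choose k * k ^ k := by exact_mod_cast card_parentMaps_le_choose_mul_pow n k
    _ ≤ (n : ℝ) ^ k / k.factorial * k ^ k := by
      gcongr
      exact Nat.choose_le_pow_div k n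
    _ = (k : ℝ) ^ k / k.factorial * (n : ℝ) ^ k := by ring
    _ ≤ Real.exp k * (n : ℝ) ^ k := by
      gcongr
      exact Real.pow_div_factorial_le_exp (k : ℝ) k.cast_nonneg k
    _ = (Real.exp 1 * n) ^ k := by rw [mul_pow, ← Real.exp_nat_mul, mul_one]

theorem exists_mem_parentMaps (C : (thresholdGraph x p).ConnectedComponent) (hk : 1 ≤ k)
    (hkC : k ≤ componentOrder C) :
    ∃ q ∈ parentMaps n k, (q.1 : Set (Fin n)) ⊆ C.supp ∧ ∀ e ∈ treeEdges q.1 q.2, x e ≤ p := by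
  obtain ⟨K, r, π, hKC, hcard, hπ⟩ := exists_isParentMap C hk hkC
  refine ⟨⟨K, π⟩, mem_parentMaps.2 ⟨⟨hcard, hπ.map_mem, hπ.map_of_notMem⟩, ?_⟩, hKC,
    fun e => hπ.le_of_mem_treeEdges⟩
  rw [hπ.card_treeEdges, hcard]

end EdgeSets

section UnionBounds

variable {n k : ℕ} {Ω : Type*} [MeasurableSpace Ω] {P : Measure Ω}
  {X : Ω → EdgeIdx n → ℝ} {σ M p : ℝ}

namespace HasTailBounds

theorem measureReal_forall_mem_cutEdges_le (h : HasTailBounds P X σ M) (hp : 0 < p) (hn : 3 ≤ n)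
    {K : Finset (Fin n)} (hK : n ≤ 3 * K.card) (hK' : 3 * K.card ≤ 2 * n) :
    P.real {ω | ∀ e ∈ cutEdges K, p < X ω e}
      ≤ Real.exp (-(3 / 8 * (p / M)) * ((n : ℝ) ^ 2 / 9)) := by
  have hM : 0 < M := h.sigma_pos.trans_le h.sigma_le
  have hKn : K.card ≤ n := by omega
  have hcut : (n : ℝ) ^ 2 / 9 ≤ (((cutEdges K).card - 1 : ℕ) : ℝ) := by
    have hpos : 1 ≤ (cutEdges K).card :=
      card_cutEdges K ▸ Nat.mul_pos (by omega) (by omega)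
    rw [Nat.cast_sub hpos, card_cutEdges]
    push_cast [hKn]
    have hlow : (n : ℝ) ≤ 3 * K.card := by exact_mod_cast hK
    have hupp : 3 * (K.card : ℝ) ≤ 2 * n := by exact_mod_cast hK'
    have hn' : (3 : ℝ) ≤ n := by exact_mod_cast hn
    nlinarith [mul_nonneg (sub_nonneg.2 hlow) (sub_nonneg.2 hupp)]
  have hnonempty : (cutEdges K).Nonempty := by
    rw [← Finset.card_pos, card_cutEdges]
    exact Nat.mul_pos (by omega) (by omega)
  refine (h.tail p hp _ hnonempty).trans ?_
  rw [← Real.exp_nat_mul, Real.exp_le_exp, mul_comm]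
  exact mul_le_mul_of_nonpos_left hcut (neg_nonpos.2 (by positivity))

variable [IsFiniteMeasure P]

theorem measureReal_le_of_exists_mem_parentMaps (h : HasTailBounds P X σ M) (hp : 0 < p)
    (hk : 2 ≤ k) {A : Set Ω} {T : Finset (Fin n) → Finset (EdgeIdx n)} {m : ℕ}
    (hdisj : ∀ q ∈ parentMaps n k, Disjoint (treeEdges q.1 q.2) (T q.1))
    (hcard : ∀ q ∈ parentMaps n k, (T q.1).card = m)
    (hA : ∀ ω ∈ A, ∃ q ∈ parentMaps n k,
      (∀ e ∈ treeEdges q.1 q.2, X ω e ≤ p) ∧ ∀ e ∈ T q.1, p < X ω e) :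
    P.real A ≤ (Real.exp 1 * n) ^ k *
      ((2 * Real.exp 1 * p / σ) ^ (k - 1) * Real.exp (-(3 / 8 * (p / M))) ^ m) := by
  have hσ := h.sigma_pos
  calc P.real A
    _ ≤ P.real (⋃ q ∈ parentMaps n k,
          {ω | (∀ e ∈ treeEdges q.1 q.2, X ω e ≤ p) ∧ ∀ e ∈ T q.1, p < X ω e}) :=
      measureReal_mono (fun ω hω => by
        simpa only [Set.mem_iUnion₂, exists_prop, Set.mem_ofPred_eq] using hA ω hω)
        (measure_ne_top _ _)
    _ ≤ ∑ q ∈ parentMaps n k,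
          P.real {ω | (∀ e ∈ treeEdges q.1 q.2, X ω e ≤ p) ∧ ∀ e ∈ T q.1, p < X ω e} :=
      measureReal_biUnion_finset_le _ _
    _ ≤ ∑ _q ∈ parentMaps n k,
          (2 * Real.exp 1 * p / σ) ^ (k - 1) * Real.exp (-(3 / 8 * (p / M))) ^ m := by
      refine Finset.sum_le_sum fun q hq => ?_
      have htree : (treeEdges q.1 q.2).card = k - 1 := (mem_parentMaps.1 hq).2
      have hjoint := h.joint p hp _ _ (Finset.card_pos.1 (by omega)) (hdisj q hq)
      rwa [htree, hcard q hq] at hjoint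
    _ ≤ _ := by
      rw [Finset.sum_const, nsmul_eq_mul]
      gcongr
      exact card_parentMaps_le n k

theorem measureReal_exists_le_componentOrder_le (h : HasTailBounds P X σ M) (hp : 0 < p)
    (hk : 2 ≤ k) :
    P.real {ω | ∃ C : (thresholdGraph (X ω) p).ConnectedComponent, k ≤ componentOrder C}
      ≤ (Real.exp 1 * n) ^ k * (2 * Real.exp 1 * p / σ) ^ (k - 1) := by
  refine (h.measureReal_le_of_exists_mem_parentMaps hp hk (T := fun _ => ∅)
    (fun _ _ => Finset.disjoint_empty_right _) (fun _ _ => Finset.card_empty) ?_).trans_eq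
    (by rw [pow_zero, mul_one])
  rintro ω ⟨C, hC⟩
  obtain ⟨q, hq, -, hle⟩ := exists_mem_parentMaps C (by omega) hC
  exact ⟨q, hq, hle, by simp⟩

theorem measureReal_exists_componentOrder_eq_le (h : HasTailBounds P X σ M) (hp : 0 < p)
    (hk : 2 ≤ k) :
    P.real {ω | ∃ C : (thresholdGraph (X ω) p).ConnectedComponent, componentOrder C = k}
      ≤ (Real.exp 1 * n) ^ k * ((2 * Real.exp 1 * p / σ) ^ (k - 1)
        * Real.exp (-(3 / 8 * (p / M))) ^ (k * (n - k))) := by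
  refine h.measureReal_le_of_exists_mem_parentMaps hp hk (T := cutEdges)
    (fun q hq => disjoint_treeEdges_cutEdges (mem_parentMaps.1 hq).1.2.1)
    (fun q hq => by rw [card_cutEdges, (mem_parentMaps.1 hq).1.1]) ?_
  rintro ω ⟨C, hC⟩
  obtain ⟨q, hq, hqC, hle⟩ := exists_mem_parentMaps C (by omega) hC.ge
  refine ⟨q, hq, hle, fun e he => lt_of_mem_cutEdges (fun u v huv => ?_) he⟩
  have hsupp : (q.1 : Set (Fin n)) = C.supp := by
    refine Set.eq_of_subset_of_ncard_le hqC ?_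
    rw [Set.ncard_coe_finset, (mem_parentMaps.1 hq).1.1]
    exact hC.le
  rw [← Finset.mem_coe, ← Finset.mem_coe, hsupp]
  exact SimpleGraph.ConnectedComponent.mem_supp_congr_adj C huv

theorem measureReal_forall_componentOrder_le (h : HasTailBounds P X σ M) (hp : 0 < p)
    (hn : 3 ≤ n) :
    P.real {ω | ∀ C : (thresholdGraph (X ω) p).ConnectedComponent, 2 * componentOrder C ≤ n}
      ≤ 2 ^ n * Real.exp (-(3 / 8 * (p / M)) * ((n : ℝ) ^ 2 / 9)) := by
  let I : Finset (Finset (Fin n)) :=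
    Finset.univ.filter fun K => n ≤ 3 * K.card ∧ 3 * K.card ≤ 2 * n
  have hI : I.card ≤ 2 ^ n := (Finset.card_le_univ I).trans (by simp)
  calc _
    _ ≤ P.real (⋃ K ∈ I, {ω | ∀ e ∈ cutEdges K, p < X ω e}) := by
      refine measureReal_mono (fun ω hω => ?_) (measure_ne_top _ _)
      obtain ⟨K, hlow, hupp, hK⟩ := exists_finset_card_of_componentOrder_le
        (thresholdGraph (X ω) p) (by simpa only [Fintype.card_fin, Set.mem_ofPred_eq] using hω)
      rw [Fintype.card_fin] at hlow hupp
      exact Set.mem_biUnion (x := K) (Finset.mem_filter_univ _ |>.2 ⟨hlow, hupp⟩)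
        fun e he => lt_of_mem_cutEdges hK he
    _ ≤ ∑ K ∈ I, P.real {ω | ∀ e ∈ cutEdges K, p < X ω e} := measureReal_biUnion_finset_le _ _
    _ ≤ ∑ _K ∈ I, Real.exp (-(3 / 8 * (p / M)) * ((n : ℝ) ^ 2 / 9)) := by
      refine Finset.sum_le_sum fun K hK => ?_
      obtain ⟨hlow, hupp⟩ := (Finset.mem_filter_univ _).1 hK
      exact h.measureReal_forall_mem_cutEdges_le hp hn hlow hupp
    _ ≤ _ := by
      rw [Finset.sum_const, nsmul_eq_mul]
      gcongr
      exact_mod_cast hI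

end HasTailBounds

end UnionBounds

section Estimates

theorem one_lt_log_of_three_le {n : ℕ} (hn : 3 ≤ n) : 1 < Real.log n := by
  rw [Real.lt_log_iff_exp_lt (by positivity)]
  exact Real.exp_one_lt_three.trans_le (by exact_mod_cast hn)

theorem two_le_ceil_mul_log {n : ℕ} (hn : 3 ≤ n) {β : ℝ} (hβ : 1 < β) :
    2 ≤ ⌈β * Real.log n⌉₊ := by
  refine Nat.lt_ceil.2 ?_
  rw [Nat.cast_one]
  exact one_lt_mul_of_lt_of_le hβ (one_lt_log_of_three_le hn).le

theorem mul_exp_neg_ceil_le {n : ℕ} (hn : 0 < n) (β : ℝ) :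
    n * Real.exp (-(⌈β * Real.log n⌉₊ : ℝ)) ≤ 1 / (n : ℝ) ^ (β - 1) := by
  have hn0 : (0 : ℝ) < n := by exact_mod_cast hn
  calc n * Real.exp (-(⌈β * Real.log n⌉₊ : ℝ))
    _ ≤ n * Real.exp (-(β * Real.log n)) := by
      gcongr
      exact Nat.le_ceil _
    _ = n * (n : ℝ) ^ (-β) := by rw [Real.rpow_def_of_pos hn0, mul_neg, mul_comm β]
    _ = 1 / (n : ℝ) ^ (β - 1) := by
      rw [one_div, ← Real.rpow_neg hn0.le, neg_sub, Real.rpow_sub hn0, Real.rpow_one,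
        Real.rpow_neg hn0.le, div_eq_mul_inv]

theorem mul_pow_le_exp {n b : ℝ} (hn : 0 ≤ n) (hb : 0 ≤ b) (hnb : n * b ≤ Real.exp (-6)) {k : ℕ}
    (hk : 2 ≤ k) :
    (Real.exp 1 * n) ^ k * b ^ (k - 1) ≤ n * Real.exp (-2) * Real.exp (-(k : ℝ)) := by
  obtain ⟨m, rfl⟩ := Nat.exists_eq_add_of_le' (one_le_two.trans hk)
  have hm : (1 : ℝ) ≤ m := by exact_mod_cast Nat.le_of_succ_le_succ hk
  calc (Real.exp 1 * n) ^ (m + 1) * b ^ (m + 1 - 1)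
    _ = Real.exp 1 * n * (Real.exp 1 * (n * b)) ^ m := by
      rw [Nat.add_sub_cancel]
      ring
    _ ≤ Real.exp 1 * n * (Real.exp 1 * Real.exp (-6)) ^ m := by gcongr
    _ = n * Real.exp (1 - 5 * m) := by
      rw [← Real.exp_add, ← Real.exp_nat_mul, mul_comm (Real.exp 1) n, mul_assoc, ← Real.exp_add]
      ring_nf
    _ ≤ n * Real.exp (-2 + -((m + 1 : ℕ) : ℝ)) := by
      gcongr
      push_cast
      linarith
    _ = n * Real.exp (-2) * Real.exp (-((m + 1 : ℕ) : ℝ)) := by rw [Real.exp_add, mul_assoc]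

theorem two_mul_exp_neg_le_one {t : ℝ} (ht : 1 ≤ t) : 2 * Real.exp (-t) ≤ 1 := by
  rw [Real.exp_neg, ← div_eq_mul_inv, div_le_one (Real.exp_pos t)]
  linarith [Real.add_one_le_exp t]

theorem sum_Icc_exp_neg_le (k m : ℕ) :
    ∑ j ∈ Finset.Icc k m, Real.exp (-(j : ℝ)) ≤ 2 * Real.exp (-(k : ℝ)) := by
  have hpow (j : ℕ) : Real.exp (-(j : ℝ)) = Real.exp (-1) ^ j := by
    rw [← Real.exp_nat_mul, mul_neg_one]
  have hhalf : 2 * Real.exp (-1) ≤ 1 := two_mul_exp_neg_le_one le_rfl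
  simp only [hpow, ← Finset.Ico_add_one_right_eq_Icc]
  refine (geom_sum_Ico_le_of_lt_one (Real.exp_pos _).le (by linarith)).trans ?_
  rw [div_le_iff₀ (by linarith)]
  nlinarith [pow_pos (Real.exp_pos (-1)) k]

theorem two_mul_mul_exp_le {u L : ℝ} (hL : 1 ≤ L) (hu : 96 * L < u) :
    2 * u * Real.exp L * Real.exp (-(3 / 16 * u)) ≤ Real.exp (-6) := by
  have hlin : u / 16 ≤ Real.exp (u / 16) := by linarith [Real.add_one_le_exp (u / 16)]
  have htwo : (2 : ℝ) ^ 5 ≤ Real.exp 5 := by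
    rw [← mul_one (5 : ℝ), show (5 : ℝ) = (5 : ℕ) by norm_num, Real.exp_nat_mul]
    gcongr
    exact Real.exp_one_gt_two.le
  calc 2 * u * Real.exp L * Real.exp (-(3 / 16 * u))
    _ = 2 ^ 5 * (u / 16) * Real.exp L * Real.exp (-(3 / 16 * u)) := by ring
    _ ≤ Real.exp 5 * Real.exp (u / 16) * Real.exp L * Real.exp (-(3 / 16 * u)) := by
      gcongr
      linarith
    _ = Real.exp (5 + L - u / 8) := by
      rw [← Real.exp_add, ← Real.exp_add, ← Real.exp_add]
      ring_nf
    _ ≤ Real.exp (-6) := Real.exp_le_exp.2 (by linarith)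

theorem exp_pow_mul_sub_le {a : ℝ} (ha : 0 ≤ a) {k n : ℕ} (hk : 2 * k ≤ n) :
    Real.exp (-a) ^ (k * (n - k)) ≤ Real.exp (-(a * n / 2)) ^ (k - 1) := by
  rw [← Real.exp_nat_mul, ← Real.exp_nat_mul, Real.exp_le_exp]
  have hkn : 2 * (k : ℝ) ≤ n := by exact_mod_cast hk
  have hpred : ((k - 1 : ℕ) : ℝ) ≤ k := by exact_mod_cast Nat.sub_le k 1
  push_cast [show k ≤ n by omega]
  have hcard : ((k - 1 : ℕ) : ℝ) * (n / 2) ≤ k * (n - k) := by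
    gcongr
    linarith
  linarith [mul_le_mul_of_nonneg_left hcard ha]

theorem exp_neg_lt_five_mul_div_log {n : ℕ} (hn : 3 ≤ n) {β : ℝ} (hβ : 1 < β) :
    Real.exp (-(n : ℝ)) < 5 * β / Real.log n := by
  rw [lt_div_iff₀ (zero_lt_one.trans (one_lt_log_of_three_le hn))]
  have hlog : Real.log n ≤ Real.exp n :=
    (Real.log_le_self n.cast_nonneg).trans (by linarith [Real.add_one_le_exp (n : ℝ)])
  calc Real.exp (-(n : ℝ)) * Real.log n ≤ Real.exp (-(n : ℝ)) * Real.exp n := by gcongr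
    _ = 1 := by rw [← Real.exp_add, neg_add_cancel, Real.exp_zero]
    _ < 5 * β := by linarith

end Estimates

section MainBounds

variable {n : ℕ} {Ω : Type*} [MeasurableSpace Ω] {P : Measure Ω} {X : Ω → EdgeIdx n → ℝ}
  {σ M β p : ℝ}

namespace HasTailBounds

theorem one_le_log (h : HasTailBounds P X σ M) : 1 ≤ Real.log (Real.exp 1 * M / σ) := by
  have hσ := h.sigma_pos
  have hM := hσ.trans_le h.sigma_le
  rw [Real.le_log_iff_exp_le (by positivity), le_div_iff₀ hσ]
  exact mul_le_mul_of_nonneg_left h.sigma_le (Real.exp_pos 1).le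

theorem mul_log_lt (h : HasTailBounds P X σ M) (hn : 0 < n)
    (hpM : 96 * M * Real.log (Real.exp 1 * M / σ) / n < p) :
    96 * Real.log (Real.exp 1 * M / σ) < p * n / M := by
  rw [div_lt_iff₀ (by positivity)] at hpM
  rw [lt_div_iff₀ (h.sigma_pos.trans_le h.sigma_le)]
  linarith

theorem mul_two_exp_mul_div_le (h : HasTailBounds P X σ M) (hn : 0 < n)
    (hpM : 96 * M * Real.log (Real.exp 1 * M / σ) / n < p) :
    n * (2 * Real.exp 1 * p / σ * Real.exp (-(3 / 8 * (p / M) * n / 2))) ≤ Real.exp (-6) := by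
  have hσ := h.sigma_pos
  have hM := hσ.trans_le h.sigma_le
  refine le_trans (le_of_eq ?_) (two_mul_mul_exp_le h.one_le_log (h.mul_log_lt hn hpM))
  rw [Real.exp_log (by positivity),
    show 3 / 8 * (p / M) * n / 2 = 3 / 16 * (p * n / M) by ring]
  field_simp

variable [IsFiniteMeasure P]

theorem subcritical (h : HasTailBounds P X σ M) (hn : 3 ≤ n) (hβ : 1 < β) (hp : 0 < p)
    (hpσ : p < Real.exp (-7) / 2 * σ / n) :
    P.real {ω | ∃ C : (thresholdGraph (X ω) p).ConnectedComponent,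
        β * Real.log n ≤ componentOrder C} < 12 / (n : ℝ) ^ (β - 1) := by
  have hσ := h.sigma_pos
  have hn0 : (0 : ℝ) < n := by positivity
  have hnb : n * (2 * Real.exp 1 * p / σ) ≤ Real.exp (-6) := by
    rw [lt_div_iff₀ hn0] at hpσ
    calc n * (2 * Real.exp 1 * p / σ)
      _ = 2 * Real.exp 1 * (p * n) / σ := by ring
      _ ≤ 2 * Real.exp 1 * (Real.exp (-7) / 2 * σ) / σ := by gcongr
      _ = Real.exp 1 * Real.exp (-7) := by field_simp
      _ = Real.exp (-6) := by
        rw [← Real.exp_add]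
        norm_num
  have hk := two_le_ceil_mul_log hn hβ
  simp only [← Nat.ceil_le]
  calc _
    _ ≤ n * Real.exp (-2) * Real.exp (-(⌈β * Real.log n⌉₊ : ℝ)) :=
      (h.measureReal_exists_le_componentOrder_le hp hk).trans
        (mul_pow_le_exp hn0.le (by positivity) hnb hk)
    _ = Real.exp (-2) * (n * Real.exp (-(⌈β * Real.log n⌉₊ : ℝ))) := by ring
    _ ≤ 1 * (1 / (n : ℝ) ^ (β - 1)) := by
      gcongr
      · exact Real.exp_le_one_iff.2 (by norm_num)
      · exact mul_exp_neg_ceil_le (by omega) β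
    _ < 12 / (n : ℝ) ^ (β - 1) := by
      rw [one_mul]
      gcongr
      norm_num

theorem measureReal_exists_componentOrder_eq_le_exp (h : HasTailBounds P X σ M) (hp : 0 < p)
    (hpM : 96 * M * Real.log (Real.exp 1 * M / σ) / n < p) {k : ℕ} (hk : 2 ≤ k)
    (hkn : 2 * k ≤ n) :
    P.real {ω | ∃ C : (thresholdGraph (X ω) p).ConnectedComponent, componentOrder C = k}
      ≤ n * Real.exp (-2) * Real.exp (-(k : ℝ)) := by
  have hσ := h.sigma_pos
  have hM := hσ.trans_le h.sigma_le
  calc _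
    _ ≤ (Real.exp 1 * n) ^ k * ((2 * Real.exp 1 * p / σ) ^ (k - 1)
          * Real.exp (-(3 / 8 * (p / M))) ^ (k * (n - k))) :=
      h.measureReal_exists_componentOrder_eq_le hp hk
    _ ≤ (Real.exp 1 * n) ^ k * ((2 * Real.exp 1 * p / σ) ^ (k - 1)
          * Real.exp (-(3 / 8 * (p / M) * n / 2)) ^ (k - 1)) := by
      gcongr
      exact exp_pow_mul_sub_le (by positivity) hkn
    _ ≤ n * Real.exp (-2) * Real.exp (-(k : ℝ)) := by
      rw [← mul_pow]
      exact mul_pow_le_exp n.cast_nonneg (by positivity)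
        (h.mul_two_exp_mul_div_le (by omega) hpM) hk

theorem supercritical_gap (h : HasTailBounds P X σ M) (hn : 3 ≤ n) (hβ : 1 < β) (hp : 0 < p)
    (hpM : 96 * M * Real.log (Real.exp 1 * M / σ) / n < p) :
    P.real {ω | ∃ C : (thresholdGraph (X ω) p).ConnectedComponent,
        β * Real.log n ≤ componentOrder C ∧ (componentOrder C : ℝ) ≤ n / 2}
      < 1 / (n : ℝ) ^ (β - 1) := by
  set k₀ := ⌈β * Real.log n⌉₊
  calc _
    _ ≤ P.real (⋃ k ∈ Finset.Icc k₀ (n / 2),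
          {ω | ∃ C : (thresholdGraph (X ω) p).ConnectedComponent, componentOrder C = k}) := by
      refine measureReal_mono ?_ (measure_ne_top _ _)
      rintro ω ⟨C, hlow, hupp⟩
      refine Set.mem_biUnion (x := componentOrder C)
        (Finset.mem_Icc.2 ⟨Nat.ceil_le.2 hlow, ?_⟩) ⟨C, rfl⟩
      rw [Nat.le_div_iff_mul_le two_pos]
      exact_mod_cast (le_div_iff₀ two_pos).1 hupp
    _ ≤ ∑ k ∈ Finset.Icc k₀ (n / 2), n * Real.exp (-2) * Real.exp (-(k : ℝ)) := by
      refine (measureReal_biUnion_finset_le _ _).trans (Finset.sum_le_sum fun k hk => ?_)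
      rw [Finset.mem_Icc] at hk
      exact h.measureReal_exists_componentOrder_eq_le_exp hp hpM
        ((two_le_ceil_mul_log hn hβ).trans hk.1) (by omega)
    _ ≤ n * Real.exp (-2) * (2 * Real.exp (-(k₀ : ℝ))) := by
      rw [← Finset.mul_sum]
      gcongr
      exact sum_Icc_exp_neg_le _ _
    _ = 2 * Real.exp (-2) * (n * Real.exp (-(k₀ : ℝ))) := by ring
    _ ≤ 2 * Real.exp (-2) * (1 / (n : ℝ) ^ (β - 1)) := by
      gcongr
      exact mul_exp_neg_ceil_le (by omega) β
    _ < 1 / (n : ℝ) ^ (β - 1) := by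
      refine mul_lt_of_lt_one_left (by positivity) ?_
      exact (mul_lt_mul_of_pos_left (Real.exp_lt_exp.2 (by norm_num)) two_pos).trans_le
        (two_mul_exp_neg_le_one le_rfl)

theorem measureReal_forall_componentOrder_le_exp (h : HasTailBounds P X σ M) (hn : 3 ≤ n)
    (hp : 0 < p) (hpM : 96 * M * Real.log (Real.exp 1 * M / σ) / n < p) :
    P.real {ω | ∀ C : (thresholdGraph (X ω) p).ConnectedComponent, 2 * componentOrder C ≤ n}
      ≤ Real.exp (-(n : ℝ)) := by
  have hu : 96 < p * n / M := by linarith [h.mul_log_lt (by omega) hpM, h.one_le_log]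
  have htwo : (2 : ℝ) ^ n ≤ Real.exp n := by
    rw [← mul_one (n : ℝ), Real.exp_nat_mul]
    gcongr
    exact Real.exp_one_gt_two.le
  calc _
    _ ≤ 2 ^ n * Real.exp (-(3 / 8 * (p / M)) * ((n : ℝ) ^ 2 / 9)) :=
      h.measureReal_forall_componentOrder_le hp hn
    _ ≤ Real.exp n * Real.exp (-(3 / 8 * (p / M)) * ((n : ℝ) ^ 2 / 9)) := by gcongr
    _ = Real.exp (n - p * n / M * n / 24) := by
      rw [← Real.exp_add]
      ring_nf
    _ ≤ Real.exp (-(n : ℝ)) := by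
      rw [Real.exp_le_exp]
      nlinarith [mul_le_mul_of_nonneg_right hu.le (n.cast_nonneg (α := ℝ))]

end HasTailBounds

theorem HasTailBounds.supercritical_giant [IsProbabilityMeasure P] (h : HasTailBounds P X σ M)
    (hn : 3 ≤ n) (hβ : 1 < β) (hp : 0 < p)
    (hpM : 96 * M * Real.log (Real.exp 1 * M / σ) / n < p) :
    1 - 5 * β / Real.log n - 1 / (n : ℝ) ^ (β - 1)
      < P.real {ω | ∃! C : (thresholdGraph (X ω) p).ConnectedComponent,
          (n : ℝ) / 2 < componentOrder C} := by
  have hcast (ω : Ω) (C : (thresholdGraph (X ω) p).ConnectedComponent) :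
      (n : ℝ) / 2 < componentOrder C ↔ Fintype.card (Fin n) < 2 * componentOrder C := by
    rw [div_lt_iff₀' two_pos, Fintype.card_fin]
    exact_mod_cast Iff.rfl
  have hcover : 1 ≤ P.real {ω | ∃! C : (thresholdGraph (X ω) p).ConnectedComponent,
        (n : ℝ) / 2 < componentOrder C}
      + P.real {ω | ∀ C : (thresholdGraph (X ω) p).ConnectedComponent,
        2 * componentOrder C ≤ n} := by
    refine le_trans (le_of_eq ?_) (measureReal_union_le _ _)
    rw [← probReal_univ (μ := P)]
    refine congrArg P.real (Set.eq_univ_of_forall fun ω => ?_).symm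
    simpa only [Set.mem_union, Set.mem_ofPred_eq, hcast, Fintype.card_fin] using
      existsUnique_lt_componentOrder_or_forall_le (thresholdGraph (X ω) p)
  have hsmall := h.measureReal_forall_componentOrder_le_exp hn hp hpM
  have hlog := exp_neg_lt_five_mul_div_log hn hβ
  have hpos : 0 < 1 / (n : ℝ) ^ (β - 1) := by positivity
  linarith

end MainBounds

theorem nontrivial_edgeIdx {n : ℕ} (hn : 3 ≤ n) : Nontrivial (EdgeIdx n) :=
  ⟨⟨(⟨0, by omega⟩, ⟨1, by omega⟩), by simp⟩, ⟨(⟨0, by omega⟩, ⟨2, by omega⟩), by simp⟩, by simp⟩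

theorem theorem2 :
    ∃ c₁ c₂ : ℝ, 0 < c₁ ∧ 0 < c₂ ∧
      ∀ (n : ℕ), 3 ≤ n →
      ∀ (Ω : Type*) [MeasurableSpace Ω] (P : Measure Ω) [IsProbabilityMeasure P]
        (X : Ω → EdgeIdx n → ℝ) (f : (EdgeIdx n → ℝ) → ℝ),
        Measurable X → Measurable f → IsLogConcaveDownMonotone f →
        P.map X = volume.withDensity (fun x => ENNReal.ofReal (f x)) →
        maxCondSecondMoment f ≠ ∞ →
      ∀ (β : ℝ), 1 < β → ∀ (p : ℝ), 0 < p →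
        (p < c₁ * sigmaMin P X / n →
          P.real {ω | ∃ C : (thresholdGraph (X ω) p).ConnectedComponent,
              β * Real.log n ≤ componentOrder C}
            < 12 / (n : ℝ) ^ (β - 1)) ∧
        (c₂ * maxCondRMS f * Real.log (Real.exp 1 * maxCondRMS f / sigmaMin P X) / n < p →
          P.real {ω | ∃ C : (thresholdGraph (X ω) p).ConnectedComponent,
              β * Real.log n ≤ componentOrder C ∧ (componentOrder C : ℝ) ≤ n / 2}
            < 1 / (n : ℝ) ^ (β - 1) ∧
          1 - 5 * β / Real.log n - 1 / (n : ℝ) ^ (β - 1)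
            < P.real {ω | ∃! C : (thresholdGraph (X ω) p).ConnectedComponent,
                (n : ℝ) / 2 < componentOrder C}) := by
  refine ⟨Real.exp (-7) / 2, 96, by positivity, by norm_num, ?_⟩
  intro n hn Ω _ P _ X f hX hf hlc hP hfin β hβ p hp
  have := nontrivial_edgeIdx hn
  have h : HasTailBounds P X (sigmaMin P X) (maxCondRMS f) := hasTailBounds hlc hf hX hP hfin
  exact ⟨fun hpσ => h.subcritical hn hβ hp hpσ, fun hpM =>
    ⟨h.supercritical_gap hn hβ hp hpM, h.supercritical_giant hn hβ hp hpM⟩⟩
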